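/- Let $\mathcal C$ be a locally finitely presentable category. A morphism $f\colon A\to B$ is *pure* if for every commutative square $f s = t z$ with $z\colon X\to Y$ a morphism between finitely presentable objects, $s\colon X\to A$ and $t\colon Y\to B$, there is $d\colon Y\to A$ with $dz=s$. For an infinite regular cardinal $\delta$, a morphism $f\colon A\to B$ is *$\delta$-presentable* if it is a $\delta$-presentable object of the comma category $(A\downarrow\mathcal C)$. Let $\mathcal M_\delta$ be the class of all $\delta$-presentable pure monomorphisms and $\mathcal N_\delta$ the class of all pure monomorphisms with $\delta$-presentable domain and codomain. For a class $\mathcal W$ of morphisms, $\mathcal W^{\vartriangle}$ is the class of objects injective with respect to all members of $\mathcal W$; for a class $\mathcal K$ of objects, $\mathcal K^{\triangledown}$ is the class of morphisms with respect to which all members of $\mathcal K$ are injective; $\mathcal W^{\Box}$ is the class of morphisms with the right lifting property with respect to $\mathcal W$; $\mathrm{Po}(\mathcal W)$ is the class of pushouts of members of $\mathcal W$; $\mathrm{ReCh}(\mathcal W)$ is the class of retracts (in $(A\downarrow\mathcal C)$, $A$ the domain) of transfinite compositions of members of $\mathcal W$; $\mathrm{Cof}(\mathcal W)=\mathrm{ReCh}(\mathrm{Po}(\mathcal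 W))$. A *weak reflector* into $\mathcal K$ is a morphism $r\colon A\to A^*$ in $\mathcal K^{\triangledown}$ with $A^*\in\mathcal K$. There is a regular cardinal $\gamma$, depending only on $\mathcal C$, such that the following hold. (1) For every regular cardinal $\delta\ge\gamma$: (a) every object $A$ has a weak reflector $A\to A^*$ into $\mathcal M_\delta^{\vartriangle}$ that is a pure monomorphism, and every weak reflector into $\mathcal M_\delta^{\vartriangle}$ is a pure monomorphism; (b) $\mathcal M_\delta=\mathrm{Po}(\mathcal N_\delta)$, and the class of $\delta$-presentable morphisms in $\mathcal M_\delta^{\vartriangle\triangledown}$ is exactly $\mathcal M_\delta$; (c) $(\mathrm{ReCh}(\mathcal M_\delta),\mathcal M_\delta^{\Box})=(\mathrm{Cof}(\mathcal N_\delta),\mathcal N_\delta^{\Box})$, and this pair is a functorial weak factorization system; up to isomorphism $\mathcal N_\delta$ is a small set, and the system is cofibrantly generated by that set. (2) For every object $A$ there is a functorial transfinite chain $A\to A_\delta\to A_{\delta'}\to\cdots$ under $A$, indexed by all regular cardinals $\delta\ge\gamma$, in which each composite $A\to A_\delta$ is the weak reflector into $\mathcal M_\delta^{\vartriangle}$ determined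 by the system in (c), i.e. lies in $\mathrm{Cof}(\mathcal N_\delta)$ and has $A_\delta\in\mathcal M_\delta^{\vartriangle}$. (3) If such a chain of $A$ weakly stabilizes, i.e. there is $\delta$ such that $A_\delta\to A_\zeta$ is a split monomorphism for all $\zeta>\delta$, then there is a pure monomorphism from $A$ to a pure-injective object (an object injective with respect to all pure monomorphisms). In particular, if this happens for every $A$, then $\mathcal C$ has enough pure-injectives. -/

import Mathlib

open CategoryTheory Limits

universe v u

namespace PureWFS

variable {C : Type u} [Category.{v} C]

/-- `f` is (`ω`-)pure: in every commutative square from a morphism `z` between finitely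
presentable objects to `f`, the top map extends along `z`. -/
def IsPure {A B : C} (f : A ⟶ B) : Prop :=
  ∀ ⦃X Y : C⦄, IsFinitelyPresentable.{v} X → IsFinitelyPresentable.{v} Y →
    ∀ (z : X ⟶ Y) (s : X ⟶ A) (t : Y ⟶ B), s ≫ f = z ≫ t → ∃ d : Y ⟶ A, z ≫ d = s

variable (C) in
/-- The class of pure monomorphisms. -/
def pureMono : MorphismProperty C := fun _ _ f => Mono f ∧ IsPure f

/-- The class of the members of `W` that are `δ`-presentable morphisms, a morphism `f : A ⟶ B`
being `δ`-presentable if it is a `δ`-presentable object of the comma category `A ↓ C`. -/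
def presentablePart (δ : Cardinal.{v}) [Fact δ.IsRegular] (W : MorphismProperty C) :
    MorphismProperty C :=
  fun _ _ f => W f ∧ IsCardinalPresentable (Under.mk f) δ

variable (C) in
/-- The class of `δ`-presentable (`ω`-)pure monomorphisms. -/
def presPureMono (δ : Cardinal.{v}) [Fact δ.IsRegular] : MorphismProperty C :=
  presentablePart δ (pureMono C)

variable (C) in
/-- The class of (`ω`-)pure monomorphisms whose domain and codomain are `δ`-presentable. -/
def pureMonoBetween (δ : Cardinal.{v}) [Fact δ.IsRegular] : MorphismProperty C :=
  fun A B f => pureMono C f ∧ IsCardinalPresentable A δ ∧ IsCardinalPresentable B δ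

/-- The objects that are injective with respect to every member of `W`. -/
def injectives (W : MorphismProperty C) : ObjectProperty C :=
  fun K => ∀ ⦃A B : C⦄ (n : A ⟶ B), W n → ∀ g : A ⟶ K, ∃ w : B ⟶ K, n ≫ w = g

/-- The morphisms with respect to which every object of `K` is injective. -/
def injectivityMaps (K : ObjectProperty C) : MorphismProperty C :=
  fun A B n => ∀ ⦃X : C⦄, K X → ∀ g : A ⟶ X, ∃ w : B ⟶ X, n ≫ w = g

/-- The morphisms `f : A ⟶ B` that are retracts, in `A ↓ C`, of a member `g : A ⟶ X` of `W`. -/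
def retractsUnder (W : MorphismProperty C) : MorphismProperty C :=
  fun A B f => ∃ (X : C) (g : A ⟶ X) (i : B ⟶ X) (r : X ⟶ B),
    W g ∧ f ≫ i = g ∧ g ≫ r = f ∧ i ≫ r = 𝟙 B

/-- Retracts of (small) transfinite compositions of members of `W`. -/
def reCh (W : MorphismProperty C) : MorphismProperty C :=
  retractsUnder (MorphismProperty.transfiniteCompositions.{v} W)

/-- The cofibrations of `W`: retracts of transfinite compositions of pushouts of members
of `W`. -/
def cof (W : MorphismProperty C) : MorphismProperty C := reCh W.pushouts

/-- `r : A ⟶ R` is a weak reflection of `A` in the full subcategory on `K`. -/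
def IsWeakReflection (K : ObjectProperty C) {A R : C} (r : A ⟶ R) : Prop :=
  K R ∧ injectivityMaps K r

/-- The regular cardinals `δ ≥ γ`, ordered by size. -/
abbrev RegularFrom (γ : Cardinal.{v}) : Type (v + 1) :=
  {δ : Cardinal.{v} // δ.IsRegular ∧ γ ≤ δ}

instance (γ : Cardinal.{v}) (δ : RegularFrom γ) : Fact δ.1.IsRegular := ⟨δ.2.1⟩

/-- A chain `A ⟶ A_δ ⟶ A_δ' ⟶ ⋯` under `A`, indexed by all regular cardinals `δ ≥ γ`, in which
each composite `A ⟶ A_δ` is a weak reflector into the `δ`-presentable-pure-mono-injectives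
determined by the weak factorization system with left class `cof (pureMonoBetween C δ)`. -/
def IsReflectorChain {γ : Cardinal.{v}} {A : C} (F : RegularFrom γ ⥤ Under A) : Prop :=
  ∀ δ : RegularFrom γ, cof (pureMonoBetween C δ.1) (F.obj δ).hom ∧
    injectives (presPureMono C δ.1) (F.obj δ).right

/-- The chain is eventually made of split monomorphisms out of a fixed stage. -/
def WeaklyStabilizes {γ : Cardinal.{v}} {A : C} (F : RegularFrom γ ⥤ Under A) : Prop :=
  ∃ δ : RegularFrom γ, ∀ (ζ : RegularFrom γ) (h : δ < ζ), IsSplitMono (F.map (homOfLE h.le)).right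

end PureWFS

/-!
The threshold `γ` comes from a downward Löwenheim–Skolem theorem, `exists_factorization_pureMono`:
for regular `δ ≥ γ`, every morphism from a `δ`-presentable object to `A` factors through a pure
monomorphism from a `δ`-presentable object to `A`. One writes `A` as a directed colimit of finitely
presentable objects and restricts this diagram to a set of fewer than `δ` indices that is closed
under solutions of finitely presentable extension problems; such sets are `δ`-directed, so that one
of them takes up the given morphism.

A pure morphism is a filtered colimit of split monomorphisms (`pureMono_eq_ind_splitMono`), because
every morphism out of `A` is, under `A`, a filtered colimit of pushouts of morphisms between
finitely presentable objects. Hence pure morphisms are stable under pushouts, filtered colimits and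
transfinite compositions, and they are closed under first factors: if `f ≫ g` is pure, so is `f`.

For every regular `κ`, a morphism is `κ`-presentable if and only if it is a pushout of a morphism
between `κ`-presentable objects (`exists_isPushout_of_isCardinalPresentable`,
`isCardinalPresentable_underMk_of_isPushout`). When the morphism is pure and `κ = δ ≥ γ`, pushing
out further along a factorization through a pure subobject makes the small morphism a first factor
of a pure one, hence pure. This is the equality `presPureMono_eq_pushouts` of `M_δ` with the class
of pushouts of `N_δ`.

Since `N_δ` is essentially small with presentable domains, it generates a weak factorization system.
Its left class has to be identified with the retracts of transfinite compositions of pushouts of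
*single* members of `N_δ`, whereas the small object argument in Mathlib attaches coproducts of
cells.
`exists_cellular_factorization` therefore runs the argument along all ordinals, attaching one cell
at each step and giving priority to the lifting problems of the earliest stage. The choice of a cell
depends on the whole chain constructed so far, and the chain itself is provided by a recursion for
functors on well-ordered classes (`exists_functor_of_exists_cocone`).

Factoring `A ⟶ ⊤` gives a morphism in `cof N_δ` to an `M_δ`-injective object, which is a weak
reflector (`isWeakReflection_of_cof`) and a pure monomorphism. Any other morphism with respect to
which the `M_δ`-injectives are injective is a first factor of this one, hence pure
(`pureMono_of_injectivityMaps`).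

The chain of weak reflectors is cut out of a continuous chain indexed by the ordinals which performs
the reflection for `δ` just after the initial ordinal of `δ` (`exists_isReflectorChain`). If it
weakly stabilizes at `δ`, then `A_δ` is a retract of `A_ζ` for arbitrarily large `ζ`, and every pure
monomorphism lies in `N_ζ` for such a `ζ`; so `A_δ` is pure-injective
(`exists_pureMono_of_weaklyStabilizes`).
-/

universe w v' u'

namespace PureWFS

/-! ### Transfinite recursion for functors on well-ordered classes -/

namespace FunctorRec

variable {J : Type w} [LinearOrder J] {D : Type u'} [Category.{v'} D]

lemma eqToHom_conj_heq {a a' b b' : D} (ha : a' = a) (hb : b = b') (f : a ⟶ b) :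
    eqToHom ha ≫ f ≫ eqToHom hb ≍ f := by
  subst ha hb
  simp

lemma eqToHom_conj_heq' {a a' a'' b b' : D} (ha : a'' = a') (ha' : a' = a) (hb : b = b')
    (f : a ⟶ b) : eqToHom ha ≫ eqToHom ha' ≫ f ≫ eqToHom hb ≍ f := by
  subst ha ha' hb
  simp

lemma eqToHom_comp_conj {a a' a'' b b' c : D} (h₁ : a = a') (h₂ : a' = a'') (h₃ : b' = b)
    (h₄ : b = b') (h₅ : a = a'') (φ : a'' ⟶ b') (ψ : b' ⟶ c) (χ : a'' ⟶ c) (hχ : χ = φ ≫ ψ) :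
    eqToHom h₅ ≫ χ = (eqToHom h₁ ≫ eqToHom h₂ ≫ φ ≫ eqToHom h₃) ≫ eqToHom h₄ ≫ ψ := by
  subst h₁ h₂ h₃ hχ
  simp

/-- The restriction of a functor along an inclusion of subsets of a linear order. -/
@[simps]
def restr {S T : Set J} (h : S ⊆ T) (F : T ⥤ D) : S ⥤ D where
  obj k := F.obj ⟨k.1, h k.2⟩
  map {k l} f := F.map (homOfLE (show (⟨k.1, h k.2⟩ : T) ≤ ⟨l.1, h l.2⟩ from leOfHom f))
  map_id k := F.map_id _
  map_comp f g := by rw [← F.map_comp, homOfLE_comp]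

lemma Iio_subset {S : Set J} (hS : IsLowerSet S) {i : J} (hi : i ∈ S) : Set.Iio i ⊆ S :=
  fun _ hk => hS hk.le hi

lemma Iic_subset {S : Set J} (hS : IsLowerSet S) {i : J} (hi : i ∈ S) : Set.Iic i ⊆ S :=
  fun _ hk => hS hk hi

/-- The value at `i` of a functor defined on a lower set, as a cocone over its values below `i`. -/
@[simps]
def coconeAt {S : Set J} (hS : IsLowerSet S) (F : S ⥤ D) (i : J) (hi : i ∈ S) :
    Cocone (restr (Iio_subset hS hi) F) where
  pt := F.obj ⟨i, hi⟩
  ι :=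
    { app k := F.map (homOfLE (show (⟨k.1, _⟩ : S) ≤ ⟨i, hi⟩ from (Set.mem_Iio.1 k.2).le))
      naturality _ _ _ := (F.map_comp _ _).symm.trans (Category.comp_id _).symm }

variable (ext : ∀ (j : J) (G : Set.Iio j ⥤ D), Cocone G)

/-- A functor on a lower set is coherent if each of its values is the one which the rule `ext`
prescribes from the preceding values. -/
def Coherent {S : Set J} (hS : IsLowerSet S) (F : S ⥤ D) : Prop :=
  ∀ (i : J) (hi : i ∈ S), coconeAt hS F i hi = ext i (restr (Iio_subset hS hi) F)

variable {ext}

lemma Coherent.restr {S T : Set J} (hS : IsLowerSet S) (hT : IsLowerSet T) (h : S ⊆ T)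
    {F : T ⥤ D} (hF : Coherent ext hT F) : Coherent ext hS (restr h F) :=
  fun i hi => hF i (h hi)

lemma pt_eq_of_eq {j : J} {G G' : Set.Iio j ⥤ D} (h : G = G') :
    (ext j G).pt = (ext j G').pt ∧
      ∀ k, (ext j G).ι.app k ≍ (ext j G').ι.app k := by
  subst h
  exact ⟨rfl, fun _ => HEq.rfl⟩

lemma ext_heq {j : J} {G G' : Set.Iio j ⥤ D} (h : G = G') : ext j G ≍ ext j G' := by
  subst h
  rfl

lemma cocone_heq {K : Type*} [Category* K] {G G' : K ⥤ D} (h : G = G') {c : Cocone G}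
    {c' : Cocone G'} (hpt : c.pt = c'.pt) (hι : ∀ k, c.ι.app k ≍ c'.ι.app k) : c ≍ c' := by
  subst h
  obtain ⟨X, ι⟩ := c
  obtain ⟨X', ι'⟩ := c'
  obtain rfl : X = X' := hpt
  obtain rfl : ι = ι' := NatTrans.ext (funext fun k => eq_of_heq (hι k))
  rfl

lemma Coherent.heq_of_restr_eq {S : Set J} {hS : IsLowerSet S} {F F' : S ⥤ D}
    (hF : Coherent ext hS F) (hF' : Coherent ext hS F') (i : J) (hi : i ∈ S)
    (h : FunctorRec.restr (Iio_subset hS hi) F = FunctorRec.restr (Iio_subset hS hi) F') :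
    F.obj ⟨i, hi⟩ = F'.obj ⟨i, hi⟩ ∧ ∀ (k : J) (hk : k < i),
      F.map (homOfLE (show (⟨k, hS hk.le hi⟩ : S) ≤ ⟨i, hi⟩ from hk.le)) ≍
        F'.map (homOfLE (show (⟨k, hS hk.le hi⟩ : S) ≤ ⟨i, hi⟩ from hk.le)) := by
  obtain ⟨h₁, h₂⟩ := pt_eq_of_eq (ext := ext) h
  rw [← hF i hi, ← hF' i hi] at h₁ h₂
  exact ⟨h₁, fun k hk => h₂ ⟨k, hk⟩⟩

lemma functor_ext_of_values {S : Set J} {hS : IsLowerSet S} {F F' : S ⥤ D}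
    (h : ∀ i (hi : i ∈ S), F.obj ⟨i, hi⟩ = F'.obj ⟨i, hi⟩ ∧ ∀ (k : J) (hk : k < i),
      F.map (homOfLE (show (⟨k, hS hk.le hi⟩ : S) ≤ ⟨i, hi⟩ from hk.le)) ≍
        F'.map (homOfLE (show (⟨k, hS hk.le hi⟩ : S) ≤ ⟨i, hi⟩ from hk.le))) : F = F' := by
  refine CategoryTheory.Functor.hext (fun i => (h i.1 i.2).1) fun k i f => ?_
  obtain ⟨k, hk⟩ := k
  obtain ⟨i, hi⟩ := i
  obtain hki | rfl := (show k ≤ i from leOfHom f).lt_or_eq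
  · exact (h i hi).2 k hki
  · obtain rfl : f = 𝟙 _ := Subsingleton.elim _ _
    rw [F.map_id, F'.map_id, (h k hi).1]

variable [WellFoundedLT J]

lemma Coherent.unique {S : Set J} {hS : IsLowerSet S} {F F' : S ⥤ D}
    (hF : Coherent ext hS F) (hF' : Coherent ext hS F') : F = F' := by
  have key : ∀ (i : J) (hi : i ∈ S), FunctorRec.restr (Iio_subset hS hi) F =
      FunctorRec.restr (Iio_subset hS hi) F' := by
    intro i
    induction i using WellFoundedLT.induction with
    | ind i ih =>
      intro hi
      refine functor_ext_of_values (hS := isLowerSet_Iio i) fun k hk => ?_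
      exact hF.heq_of_restr_eq hF' k (hS (le_of_lt hk) hi) (ih k hk (hS (le_of_lt hk) hi))
  exact functor_ext_of_values (hS := hS) fun i hi => hF.heq_of_restr_eq hF' i hi (key i hi)

section Glue

variable {S : Set J} (hS : IsLowerSet S)
  (G : ∀ i ∈ S, Set.Iic i ⥤ D) (hG : ∀ i hi, Coherent ext (isLowerSet_Iic i) (G i hi))

include hG in
lemma glue_compat {k i : J} (hk : k ∈ S) (hi : i ∈ S) (hki : k ≤ i) :
    G k hk = restr (Set.Iic_subset_Iic.2 hki) (G i hi) :=
  (hG k hk).unique ((hG i hi).restr (isLowerSet_Iic k) _ _)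

include hG in
lemma glue_obj {k i : J} (hk : k ∈ S) (hi : i ∈ S) (hki : k ≤ i) :
    (G k hk).obj ⟨k, Set.mem_Iic.2 le_rfl⟩ = (G i hi).obj ⟨k, Set.mem_Iic.2 hki⟩ := by
  rw [glue_compat G hG hk hi hki]
  rfl

/-- The functor glued from coherent functors on the initial segments of a lower set. -/
def glue : S ⥤ D where
  obj i := (G i.1 i.2).obj ⟨i.1, Set.mem_Iic.2 le_rfl⟩
  map {k i} f := eqToHom (glue_obj G hG k.2 i.2 (leOfHom f)) ≫
    (G i.1 i.2).map (homOfLE (show (⟨k.1, Set.mem_Iic.2 (leOfHom f)⟩ : Set.Iic i.1) ≤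
      ⟨i.1, Set.mem_Iic.2 le_rfl⟩ from leOfHom f))
  map_id i := by
    simp only [eqToHom_refl, Category.id_comp]
    exact (G i.1 i.2).map_id _
  map_comp {k i l} f g := by
    have h := Functor.congr_hom (glue_compat G hG i.2 l.2 (leOfHom g))
      (homOfLE (show (⟨k.1, Set.mem_Iic.2 (leOfHom f)⟩ : Set.Iic i.1) ≤
      ⟨i.1, Set.mem_Iic.2 le_rfl⟩ from leOfHom f))
    rw [h]
    exact eqToHom_comp_conj _ _ _ _ _ _ _ _ ((G l.1 l.2).map_comp _ _)

lemma glue_restr (i : J) (hi : i ∈ S) :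
    restr (Iic_subset hS hi) (glue G hG) = G i hi := by
  refine CategoryTheory.Functor.hext (fun k => glue_obj G hG (hS k.2 hi) hi k.2) fun k l f => ?_
  have h := Functor.congr_hom (glue_compat G hG (hS l.2 hi) hi l.2)
    (homOfLE (show (⟨k.1, Set.mem_Iic.2 (leOfHom f)⟩ : Set.Iic l.1) ≤
      ⟨l.1, Set.mem_Iic.2 le_rfl⟩ from leOfHom f))
  have hl := glue_obj G hG (hS l.2 hi) hi l.2
  have hk := glue_obj G hG (hS k.2 hi) (hS l.2 hi) (leOfHom f)
  refine (heq_of_eq (congrArg (eqToHom hk ≫ ·) h)).trans ?_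
  exact eqToHom_conj_heq' hk (hk.symm.trans (glue_obj G hG (hS k.2 hi) hi k.2)) hl.symm
    ((G i hi).map f)

lemma glue_coherent : Coherent ext hS (glue G hG) := by
  intro i hi
  have h : Coherent ext (isLowerSet_Iic i) (restr (Iic_subset hS hi) (glue G hG)) := by
    rw [glue_restr hS]
    exact hG i hi
  exact h i (Set.mem_Iic.2 le_rfl)

end Glue

lemma exists_coherent_Iic (i : J) :
    ∃ F : Set.Iic i ⥤ D, Coherent ext (isLowerSet_Iic i) F := by
  induction i using WellFoundedLT.induction with
  | ind i ih =>
    choose G hG using ih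
    let F₀ : Set.Iio i ⥤ D := glue (S := Set.Iio i) G hG
    have hF₀ : Coherent ext (isLowerSet_Iio i) F₀ := glue_coherent _ G hG
    let F := SmallObject.SuccStruct.ofCocone (ext i F₀)
    have hF : restr Set.Iio_subset_Iic_self F = F₀ := by
      refine CategoryTheory.Functor.hext
        (fun k => SmallObject.SuccStruct.ofCocone_obj_eq _ k.1 k.2) fun k l f => ?_
      have := SmallObject.SuccStruct.ofCocone_map (ext i F₀) k.1 l.1 (leOfHom f) l.2
      refine (heq_of_eq this).trans ?_
      exact eqToHom_conj_heq (SmallObject.SuccStruct.ofCocone_obj_eq _ k.1 k.2)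
        (SmallObject.SuccStruct.ofCocone_obj_eq _ l.1 l.2).symm (F₀.map f)
    refine ⟨F, fun k hk => ?_⟩
    obtain hk' | rfl := (show k ≤ i from hk).lt_or_eq
    · have := hF₀ k hk'
      rw [← hF] at this
      exact this
    · have key : coconeAt (isLowerSet_Iic k) F k hk ≍ ext k F₀ := by
        refine cocone_heq hF (SmallObject.SuccStruct.ofCocone_obj_eq_pt _) fun l => ?_
        refine (heq_of_eq (SmallObject.SuccStruct.ofCocone_map_to_top (ext k F₀) l.1 l.2)).trans ?_
        exact eqToHom_conj_heq (SmallObject.SuccStruct.ofCocone_obj_eq _ l.1 l.2)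
          (SmallObject.SuccStruct.ofCocone_obj_eq_pt _).symm ((ext k F₀).ι.app l)
      exact eq_of_heq (key.trans (ext_heq hF.symm))

/-- A rule which prolongs each functor on a proper initial segment of a well-ordered class has a
solution on the whole class. -/
theorem exists_coherent : ∃ F : (Set.univ : Set J) ⥤ D, Coherent ext isLowerSet_univ F := by
  choose G hG using fun i : J => exists_coherent_Iic (ext := ext) i
  exact ⟨glue (fun i _ => G i) (fun i _ => hG i), glue_coherent _ _ _⟩

end FunctorRec

/-- Let `R j G c` be a condition on a cocone `c` over a functor `G` defined below `j`. If each `G`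
has a cocone satisfying it, there is a functor on the whole well-ordered class whose value at
each `j` satisfies it over the restriction to the preceding values. -/
theorem exists_functor_of_exists_cocone {J : Type w} [LinearOrder J] [WellFoundedLT J]
    {D : Type u'} [Category.{v'} D] (R : ∀ (j : J) (G : Set.Iio j ⥤ D), Cocone G → Prop)
    (hR : ∀ j G, ∃ c, R j G c) :
    ∃ F : J ⥤ D, ∀ j, R j ((Set.principalSegIio j).monotone.functor ⋙ F)
      ((Set.principalSegIio j).cocone F) := by
  choose ext hext using hR
  obtain ⟨F, hF⟩ := FunctorRec.exists_coherent (ext := ext)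
  let e : J ⥤ (Set.univ : Set J) :=
    (show Monotone (fun j : J => (⟨j, trivial⟩ : (Set.univ : Set J))) from fun _ _ h => h).functor
  refine ⟨e ⋙ F, fun j => ?_⟩
  have := hext j (FunctorRec.restr (FunctorRec.Iio_subset isLowerSet_univ (Set.mem_univ j)) F)
  rw [← hF j (Set.mem_univ j)] at this
  exact this

/-! ### Continuous chains indexed by the ordinals -/

section OrdinalChains

variable {C : Type u} [Category.{v} C]

instance hasColimitsOfShape_Iio_ordinal [HasColimitsOfSize.{v, v} C] (α : Ordinal.{v}) :
    HasColimitsOfShape (Set.Iio α) C :=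
  hasColimitsOfShape_of_equivalence (orderIsoShrink.{v} (Set.Iio α)).symm.equivalence

/-- The cocone over a functor on `Iio (succ α)` determined by a map out of its last value. -/
@[simps]
def coconeOfSucc {α : Ordinal.{v}} (G : Set.Iio (Order.succ α) ⥤ C) {X : C}
    (f : G.obj ⟨α, Order.lt_succ α⟩ ⟶ X) : Cocone G where
  pt := X
  ι :=
    { app k := G.map (homOfLE (show k ≤ ⟨α, Order.lt_succ α⟩ from
        (show k.1 ≤ α from Order.lt_succ_iff.1 k.2))) ≫ f
      naturality k l g := by
        dsimp
        rw [Category.comp_id, ← Category.assoc, ← G.map_comp]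
        rfl }

/-- Construction of continuous chains by transfinite recursion, where the successor step may be
subject to a condition that involves the whole chain constructed so far. -/
theorem exists_ordinal_chain [HasColimitsOfSize.{v, v} C] (A : C)
    (P : ∀ (α : Ordinal.{v}) (G : Set.Iio (Order.succ α) ⥤ C) (X : C)
      (_ : G.obj ⟨α, Order.lt_succ α⟩ ⟶ X), Prop)
    (hP : ∀ α G, ∃ X f, P α G X f) :
    ∃ F : Ordinal.{v} ⥤ C, F.IsWellOrderContinuous ∧ F.obj ⊥ = A ∧
      ∀ α, P α ((Set.principalSegIio (Order.succ α)).monotone.functor ⋙ F)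
        (F.obj (Order.succ α)) (F.map (homOfLE (Order.le_succ α))) := by
  obtain ⟨F, hF⟩ := exists_functor_of_exists_cocone (J := Ordinal.{v}) (D := C)
    (fun j G c => (j = ⊥ → c.pt = A) ∧ (Order.IsSuccLimit j → Nonempty (IsColimit c)) ∧
      ∀ (α : Ordinal.{v}) (h : Order.succ α = j),
        P α ((show Monotone (Set.inclusion (show Set.Iio (Order.succ α) ⊆ Set.Iio j by rw [h]))
          from fun _ _ hab => hab).functor ⋙ G) c.pt
          (c.ι.app ⟨α, h ▸ Order.lt_succ α⟩)) (by
      intro j G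
      induction j using SuccOrder.limitRecOn with
      | isMin j hj =>
        have : IsEmpty (Set.Iio j) := ⟨fun k => hj.not_lt k.2⟩
        refine ⟨⟨A, { app k := isEmptyElim k, naturality k := isEmptyElim k }⟩, fun _ => rfl,
          fun h => (h.not_isMin hj).elim, fun α h => ?_⟩
        exact (hj.not_lt (h ▸ Order.lt_succ α)).elim
      | succ α _ _ =>
        obtain ⟨X, f, hf⟩ := hP α G
        refine ⟨coconeOfSucc G f, fun h => (Order.succ_ne_bot α h).elim,
          fun h => (Order.not_isSuccLimit_succ α h).elim, fun β h => ?_⟩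
        obtain rfl := Order.succ_injective h
        have hf' : (coconeOfSucc G f).ι.app ⟨β, Order.lt_succ β⟩ = f :=
          (congrArg (· ≫ f) (G.map_id _)).trans (Category.id_comp f)
        rw [← hf'] at hf
        exact hf
      | isSuccLimit j hj _ =>
        refine ⟨colimit.cocone G, fun h => ?_, fun _ => ⟨colimit.isColimit G⟩, fun α h => ?_⟩
        · exact (hj.ne_bot h).elim
        · exact (Order.not_isSuccLimit_succ α (h ▸ hj)).elim)
  exact ⟨F, ⟨fun m hm => (hF m).2.1 hm⟩, (hF ⊥).1 rfl, fun α => (hF _).2.2 α rfl⟩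

/-- In a continuous chain whose steps before `α` lie in `W`, the map from the bottom to stage `α`
is a transfinite composition of members of `W`. -/
lemma transfiniteCompositions_map_bot {F : Ordinal.{v} ⥤ C} (hF : F.IsWellOrderContinuous)
    (W : MorphismProperty C) (α : Ordinal.{v})
    (hW : ∀ β < α, W (F.map (homOfLE (Order.le_succ β)))) :
    MorphismProperty.transfiniteCompositions.{v} W (F.map (homOfLE bot_le : ⊥ ⟶ α)) := by
  let h : W.TransfiniteCompositionOfShape (Set.Iic α) (F.map (homOfLE bot_le : ⊥ ⟶ α)) :=
    { F := (Set.initialSegIic α).monotone.functor ⋙ F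
      isoBot := Iso.refl _
      incl :=
        { app i := F.map (homOfLE i.2)
          naturality i i' φ := (F.map_comp _ _).symm.trans (Category.comp_id _).symm }
      isColimit := colimitOfDiagramTerminal isTerminalTop _
      fac := Category.id_comp _
      map_mem i hi := by
        have := hW i.1 (by
          rw [not_isMax_iff] at hi
          obtain ⟨i', hi'⟩ := hi
          exact lt_of_lt_of_le hi' i'.2)
        rw [← W.arrow_mk_mem_toSet_iff] at this ⊢
        have eq : Arrow.mk ((Subtype.mono_coe _).functor.map (homOfLE (Order.le_succ i))) =
          Arrow.mk (homOfLE (Order.le_succ i.1)) :=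
            Arrow.ext rfl (Set.Iic.coe_succ_of_not_isMax hi) rfl
        replace eq := congr_arg F.mapArrow.obj eq
        convert! this using 1 }
  exact MorphismProperty.transfiniteCompositionsOfShape_le_transfiniteCompositions _ _ _
    (h.ofOrderIso (orderIsoShrink.{v} (Set.Iic α)).symm).mem

end OrdinalChains

/-! ### The small object argument, attaching one cell at a time -/

section SmallObjectArgument

lemma exists_seq_of_ordinals (T : Type v) [LinearOrder T] [WellFoundedLT T]
    (h : Ordinal.{v} → Ordinal.{v}) : ∃ g : T → Ordinal.{v}, ∀ i j, i < j → h (g i) < g j := by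
  let r : ∀ i : T, (∀ j, j < i → Ordinal.{v}) → Ordinal.{v} := fun i g =>
    ⨆ j : Set.Iio i, Order.succ (h (g j.1 j.2))
  let g : T → Ordinal.{v} := (wellFounded_lt (α := T)).fix r
  have hg (i : T) : g i = ⨆ j : Set.Iio i, Order.succ (h (g j.1)) := WellFounded.fix_eq _ r i
  refine ⟨g, fun i j hij => ?_⟩
  rw [hg j]
  exact (Order.lt_succ _).trans_le
    (Ordinal.le_iSup (fun k : Set.Iio j => Order.succ (h (g k.1))) ⟨i, hij⟩)

/-- Closure points: for each `h` there are limit ordinals of arbitrarily large cofinality below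
which the values of `h` at cofinally many ordinals stay. -/
lemma exists_closure_ordinal (κ : Cardinal.{v}) [hκ : Fact κ.IsRegular]
    (h : Ordinal.{v} → Ordinal.{v}) :
    ∃ l : Ordinal.{v}, Order.IsSuccLimit l ∧ IsCardinalFiltered (Set.Iio l) κ ∧
      ∀ a < l, ∃ b < l, a ≤ b ∧ h b < l := by
  let T := κ.ord.ToType
  have : NoMaxOrder T := Cardinal.noMaxOrder hκ.out.aleph0_le
  have : Nonempty T := (isFiltered_of_isCardinalFiltered T κ).nonempty
  obtain ⟨g, hg⟩ := exists_seq_of_ordinals T (fun a => max (h a) a)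
  have hlt (a : Ordinal.{v}) : a < ⨆ i, Order.succ (g i) ↔ ∃ i, a ≤ g i := by
    simp [Ordinal.lt_iSup_iff]
  refine ⟨⨆ i, Order.succ (g i), ?_, ?_, fun a ha => ?_⟩
  · refine ⟨fun hmin => ?_, fun a ha => ?_⟩
    · exact (hmin.not_lt ((hlt _).2 ⟨Classical.arbitrary T, le_rfl⟩))
    · obtain ⟨i, hi⟩ := (hlt a).1 ha.lt
      obtain ⟨j, hj⟩ := exists_gt i
      exact ha.2 (c := g j) (lt_of_le_of_lt hi ((le_max_right _ _).trans_lt (hg i j hj)))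
        ((hlt _).2 ⟨j, le_rfl⟩)
  · refine ⟨fun {A} _ F hA => ?_⟩
    choose i hi using fun a : A => (hlt (F.obj a).1).1 (F.obj a).2
    let m := IsCardinalFiltered.max i (hasCardinalLT_of_hasCardinalLT_arrow hA)
    have hm (a : A) : i a ≤ m := leOfHom (IsCardinalFiltered.toMax i _ a)
    have hg' : Monotone g := fun i j hij => by
      obtain hij | rfl := hij.lt_or_eq
      · exact ((le_max_right _ _).trans_lt (hg i j hij)).le
      · exact le_rfl
    exact ⟨Cocone.mk ⟨g m, (hlt _).2 ⟨m, le_rfl⟩⟩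
      { app a := homOfLE ((hi a).trans (hg' (hm a)))
        naturality _ _ _ := rfl }⟩
  · obtain ⟨i, hi⟩ := (hlt a).1 ha
    obtain ⟨j, hj⟩ := exists_gt i
    exact ⟨g i, (hlt _).2 ⟨i, le_rfl⟩, hi, (hlt _).2
      ⟨j, ((le_max_left _ _).trans_lt (hg i j hj)).le⟩⟩

variable {C : Type u} [Category.{v} C] {B : C} {ι : Type v} {dom cod : ι → C}
  (w : ∀ i, dom i ⟶ cod i)

/-- The lifting problems of members of the family `w` against the structure map of an object
over `B`. -/
@[ext]
structure LiftProblem (Y : Over B) where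
  /-- the member of the family -/
  i : ι
  /-- the top map of the square -/
  top : dom i ⟶ Y.left
  /-- the bottom map of the square -/
  bot : cod i ⟶ B
  comm : top ≫ Y.hom = w i ≫ bot

namespace LiftProblem

variable {w}

instance (Y : Over B) : Small.{v} (LiftProblem w Y) :=
  small_of_injective (β := Σ i, (dom i ⟶ Y.left) × (cod i ⟶ B))
    (f := fun p => ⟨p.i, p.top, p.bot⟩) (by
      rintro ⟨i, a, b, _⟩ ⟨i', a', b', _⟩ h
      simp only [Sigma.mk.injEq] at h
      obtain ⟨rfl, h⟩ := h
      simp only [heq_eq_eq, Prod.mk.injEq] at h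
      obtain ⟨rfl, rfl⟩ := h
      rfl)

/-- The image of a lifting problem under a morphism over `B`. -/
@[simps]
def push {Y Z : Over B} (p : LiftProblem w Y) (φ : Y ⟶ Z) : LiftProblem w Z where
  i := p.i
  top := p.top ≫ φ.left
  bot := p.bot
  comm := by simp [p.comm]

/-- A lifting problem is solved if it has a lift. -/
def Solved {Y : Over B} (p : LiftProblem w Y) : Prop :=
  ∃ l : cod p.i ⟶ Y.left, w p.i ≫ l = p.top ∧ l ≫ Y.hom = p.bot

lemma Solved.push {Y Z : Over B} {p : LiftProblem w Y} (hp : p.Solved) (φ : Y ⟶ Z) :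
    (p.push φ).Solved := by
  obtain ⟨l, h₁, h₂⟩ := hp
  exact ⟨l ≫ φ.left, by
    change w p.i ≫ l ≫ φ.left = p.top ≫ φ.left
    rw [reassoc_of% h₁], by
    change (l ≫ φ.left) ≫ Z.hom = p.bot
    rw [Category.assoc, Over.w, h₂]⟩

@[simp]
lemma push_id {Y : Over B} (p : LiftProblem w Y) : p.push (𝟙 Y) = p := by
  obtain ⟨i, a, b, _⟩ := p
  simp [LiftProblem.push]

lemma push_push {Y Z T : Over B} (p : LiftProblem w Y) (φ : Y ⟶ Z) (ψ : Z ⟶ T) :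
    (p.push φ).push ψ = p.push (φ ≫ ψ) := by
  obtain ⟨i, a, b, _⟩ := p
  simp [LiftProblem.push]

end LiftProblem

open LiftProblem

/-- The successor step of the construction: unless all lifting problems at the last stage are
solved, a cell is attached that solves an unsolved lifting problem, among those that come from
the earliest possible stage. -/
def CellStep (α : Ordinal.{v}) (G : Set.Iio (Order.succ α) ⥤ Over B) (X : Over B)
    (f : G.obj ⟨α, Order.lt_succ α⟩ ⟶ X) : Prop :=
  (∀ p : LiftProblem w (G.obj ⟨α, Order.lt_succ α⟩), p.Solved) ∨
  ∃ p : LiftProblem w (G.obj ⟨α, Order.lt_succ α⟩), ¬ p.Solved ∧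
    (∀ (β : Set.Iio (Order.succ α)) (hβ : β ≤ ⟨α, Order.lt_succ α⟩) (q : LiftProblem w (G.obj β)),
      ¬ (q.push (G.map (homOfLE hβ))).Solved →
        ∃ (β' : Set.Iio (Order.succ α)) (hβ' : β' ≤ β) (q' : LiftProblem w (G.obj β')),
          q'.push (G.map (homOfLE (hβ'.trans hβ))) = p) ∧
    ∃ b : cod p.i ⟶ X.left, IsPushout p.top (w p.i) f.left b ∧ b ≫ X.hom = p.bot

lemma exists_cellStep [HasPushouts C] (α : Ordinal.{v}) (G : Set.Iio (Order.succ α) ⥤ Over B) :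
    ∃ X f, CellStep w α G X f := by
  by_cases h : ∀ p : LiftProblem w (G.obj ⟨α, Order.lt_succ α⟩), p.Solved
  · exact ⟨_, 𝟙 _, Or.inl h⟩
  · push Not at h
    obtain ⟨p₀, hp₀⟩ := h
    let S : Set (Set.Iio (Order.succ α)) := {β | ∃ (hβ : β ≤ ⟨α, Order.lt_succ α⟩)
      (q : LiftProblem w (G.obj β)), ¬ (q.push (G.map (homOfLE hβ))).Solved}
    have hS : S.Nonempty := ⟨⟨α, Order.lt_succ α⟩, le_rfl, p₀, by
      have : G.map (homOfLE (le_refl (⟨α, Order.lt_succ α⟩ : Set.Iio (Order.succ α)))) = 𝟙 _ :=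
        G.map_id _
      rwa [this, push_id]⟩
    obtain ⟨β₀, ⟨hβ₀, q₀, hq₀⟩, hmin⟩ := WellFounded.has_min
      (wellFounded_lt (α := Set.Iio (Order.succ α))) S hS
    let p := q₀.push (G.map (homOfLE hβ₀))
    refine ⟨Over.mk (pushout.desc (G.obj ⟨α, Order.lt_succ α⟩).hom p.bot p.comm),
      Over.homMk (pushout.inl p.top (w p.i)) (pushout.inl_desc _ _ _),
      Or.inr ⟨p, hq₀, fun β hβ q hq => ?_, ?_⟩⟩
    · have hβ' : β₀ ≤ β := not_lt.1 (hmin β ⟨hβ, q, hq⟩)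
      exact ⟨β₀, hβ', q₀, rfl⟩
    · exact ⟨pushout.inr p.top (w p.i), IsPushout.of_hasPushout _ _, pushout.inr_desc _ _ _⟩

section

variable {F : Ordinal.{v} ⥤ Over B}
  (hF : ∀ α, CellStep w α ((Set.principalSegIio (Order.succ α)).monotone.functor ⋙ F)
    (F.obj (Order.succ α)) (F.map (homOfLE (Order.le_succ α))))

include hF in
lemma cellStep_cases (α : Ordinal.{v}) : (∀ p : LiftProblem w (F.obj α), p.Solved) ∨
    ∃ p : LiftProblem w (F.obj α), ¬ p.Solved ∧
      (∀ (β : Ordinal.{v}) (hβ : β ≤ α) (q : LiftProblem w (F.obj β)),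
        ¬ (q.push (F.map (homOfLE hβ))).Solved →
          ∃ (q' : LiftProblem w (F.obj β)), q'.push (F.map (homOfLE hβ)) = p) ∧
      ∃ b : cod p.i ⟶ (F.obj (Order.succ α)).left,
        IsPushout p.top (w p.i) (F.map (homOfLE (Order.le_succ α))).left b ∧
          b ≫ (F.obj (Order.succ α)).hom = p.bot := by
  obtain h | ⟨p, hp, hmin, hb⟩ := hF α
  · exact Or.inl h
  · refine Or.inr ⟨p, hp, fun β hβ q hq => ?_, hb⟩
    obtain ⟨β', hβ', q', hq'⟩ := hmin ⟨β, Order.lt_succ_iff.2 hβ⟩ hβ q hq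
    refine ⟨q'.push (F.map (homOfLE (show β'.1 ≤ β from hβ'))), ?_⟩
    rw [push_push, ← F.map_comp]
    exact hq'

include hF in
/-- All lifting problems at a stage get solved later, because each step until then solves one of
them, or one of the equally few problems that come from earlier stages. -/
lemma exists_stage_solving (β : Ordinal.{v}) :
    ∃ (α : Ordinal.{v}) (h : β ≤ α),
      ∀ q : LiftProblem w (F.obj β), (q.push (F.map (homOfLE h))).Solved := by
  by_contra! hcon
  have key : ∀ γ : Ordinal.{v}, ∃ q : LiftProblem w (F.obj β),
      ¬ (q.push (F.map (homOfLE (le_self_add : β ≤ β + γ)))).Solved ∧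
      (q.push (F.map (homOfLE ((le_self_add : β ≤ β + γ).trans (Order.le_succ _))))).Solved := by
    intro γ
    obtain ⟨q, hq⟩ := hcon (β + γ) le_self_add
    obtain h | ⟨p, hp, hmin, b, hb, hb'⟩ := cellStep_cases w hF (β + γ)
    · exact (hq (h _)).elim
    · obtain ⟨q', rfl⟩ := hmin β le_self_add q hq
      refine ⟨q', hp, ?_⟩
      rw [← homOfLE_comp (le_self_add : β ≤ β + γ) (Order.le_succ _), F.map_comp, ← push_push]
      exact ⟨b, hb.w.symm, hb'⟩
  choose q hq hq' using key
  refine not_injective_of_ordinal q fun γ γ' h => ?_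
  by_contra hne
  wlog hlt : γ < γ' generalizing γ γ'
  · exact this _ _ h.symm (Ne.symm hne) (lt_of_le_of_ne (not_lt.1 hlt) (Ne.symm hne))
  apply hq γ'
  have hle : Order.succ (β + γ) ≤ β + γ' := Order.succ_le_of_lt (by gcongr)
  have := (hq' γ).push (F.map (homOfLE hle))
  rwa [push_push, ← F.map_comp, homOfLE_comp, h] at this

end

lemma cof_le_llp_rlp (W : MorphismProperty C) : cof W ≤ W.rlp.llp := by
  rintro A D f ⟨X, g, i, r, hg, hi, hr, hir⟩
  have hg' : W.rlp.llp g := by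
    have := MorphismProperty.transfiniteCompositions_le_llp_rlp.{v} W.pushouts g hg
    rwa [MorphismProperty.rlp_pushouts] at this
  refine MorphismProperty.of_retract (P := W.rlp.llp) (f := f) (g := g) ?_ hg'
  exact
    { i := Arrow.homMk (𝟙 A) i (by simp [hi])
      r := Arrow.homMk (𝟙 A) r (by simp [hr])
      retract := by
        ext
        · simp
        · simpa using hir }

variable [HasColimitsOfSize.{v, v} C]

instance preservesColimitsOfShape_Iio_forget (α : Ordinal.{v}) :
    PreservesColimitsOfShape (Set.Iio α) (Over.forget B) :=
  preservesColimitsOfShape_of_equiv (orderIsoShrink.{v} (Set.Iio α)).symm.equivalence _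

/-- The small object argument: a morphism factors as a transfinite composition of pushouts of
members of `w`, each attaching a single cell, followed by a morphism with the right lifting
property. -/
theorem exists_cellular_factorization (κ : Cardinal.{v}) [Fact κ.IsRegular]
    (hw : ∀ i, IsCardinalPresentable (dom i) κ) {A : C} (g : A ⟶ B) :
    ∃ (Z : C) (i : A ⟶ Z) (p : Z ⟶ B),
      MorphismProperty.transfiniteCompositions.{v} (MorphismProperty.ofHoms w).pushouts i ∧
        (MorphismProperty.ofHoms w).rlp p ∧ i ≫ p = g := by
  obtain ⟨F, hcont, h₀, hF⟩ := exists_ordinal_chain (Over.mk g) (CellStep w)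
    (fun α G => exists_cellStep w α G)
  have hcont' : (F ⋙ Over.forget B).IsWellOrderContinuous :=
    ⟨fun m hm => ⟨isColimitOfPreserves (Over.forget B)
      (F.isColimitOfIsWellOrderContinuous m hm)⟩⟩
  have hsolved : ∃ α, ∀ p : LiftProblem w (F.obj α), p.Solved := by
    by_contra! hne
    choose h hle hh using exists_stage_solving w hF
    -- a lifting problem at a stage `l` of cofinality at least `κ` comes from an earlier stage, and
    -- is solved before `l` if `l` is a closure point of `h`
    obtain ⟨l, hl, _, hl'⟩ := exists_closure_ordinal κ h
    obtain ⟨p, hp⟩ := hne l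
    have := hw p.i
    have : EssentiallySmall.{v} (Set.Iio l) :=
      essentiallySmall_of_small_of_locallySmall _
    obtain ⟨a, ha, t, ht⟩ : ∃ (a : Ordinal.{v}) (ha : a < l) (t : dom p.i ⟶ (F.obj a).left),
        t ≫ (F.map (homOfLE ha.le)).left = p.top := by
      obtain ⟨⟨a, ha⟩, t, ht⟩ := IsCardinalPresentable.exists_hom_of_isColimit κ
        ((F ⋙ Over.forget B).isColimitOfIsWellOrderContinuous l hl) p.top
      exact ⟨a, ha, t, ht⟩
    obtain ⟨b, hb, hab, hbl⟩ := hl' a ha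
    let q : LiftProblem w (F.obj b) :=
      { i := p.i
        top := t ≫ (F.map (homOfLE hab)).left
        bot := p.bot
        comm := by
          rw [← p.comm, ← ht, Category.assoc, Category.assoc, Over.w, Over.w] }
    have htop : (t ≫ (F.map (homOfLE hab)).left) ≫ (F.map (homOfLE hb.le)).left = p.top := by
      rw [← ht, Category.assoc, ← Over.comp_left, ← F.map_comp, homOfLE_comp]
    have hq : q.push (F.map (homOfLE hb.le)) = p := by
      ext
      · rfl
      · exact heq_of_eq htop
      · rfl
    apply hp
    have := (hh b q).push (F.map (homOfLE hbl.le))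
    rwa [push_push, ← F.map_comp, homOfLE_comp, hq] at this
  -- minimality of `α` ensures that each step before `α` attaches a cell
  obtain ⟨α, hα, hmin⟩ := WellFounded.has_min (wellFounded_lt (α := Ordinal.{v}))
    {α | ∀ p : LiftProblem w (F.obj α), p.Solved} hsolved
  have htc := transfiniteCompositions_map_bot hcont' (MorphismProperty.ofHoms w).pushouts α
    (fun β hβ => by
      obtain h | ⟨p, _, _, b, hb, _⟩ := cellStep_cases w hF β
      · exact (hmin β h hβ).elim
      · exact MorphismProperty.pushouts_mk _ hb ⟨p.i⟩)
  have hrlp : (MorphismProperty.ofHoms w).rlp (F.obj α).hom := by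
    rintro _ _ _ ⟨i⟩
    refine ⟨fun {t b} sq => ?_⟩
    obtain ⟨l, h₁, h₂⟩ := hα ⟨i, t, b, sq.w⟩
    exact ⟨⟨l, h₁, h₂⟩⟩
  have hY : ∀ Y : Over B, F.obj ⊥ = Y → ∃ (Z : C) (i : Y.left ⟶ Z) (p : Z ⟶ B),
      MorphismProperty.transfiniteCompositions.{v} (MorphismProperty.ofHoms w).pushouts i ∧
        (MorphismProperty.ofHoms w).rlp p ∧ i ≫ p = Y.hom := by
    rintro _ rfl
    exact ⟨_, _, (F.obj α).hom, htc, hrlp, Over.w _⟩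
  exact hY _ h₀

/-- The left class of the weak factorization system generated by a small class `W` with presentable
domains consists of the retracts of transfinite compositions of pushouts of single members
of `W`. -/
theorem llp_rlp_eq_cof (W : MorphismProperty C) [MorphismProperty.IsSmall.{v} W]
    (κ : Cardinal.{v}) [Fact κ.IsRegular]
    (hW : ∀ ⦃X Y : C⦄ (f : X ⟶ Y), W f → IsCardinalPresentable X κ) : W.rlp.llp = cof W := by
  refine le_antisymm (fun A D f hf => ?_) (cof_le_llp_rlp W)
  obtain ⟨ι, dom, cod, w, rfl⟩ := (MorphismProperty.isSmall_iff_eq_ofHoms.{v} W).1 inferInstance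
  obtain ⟨Z, i, p, hi, hp, rfl⟩ := exists_cellular_factorization w κ (fun i => hW _ ⟨i⟩) f
  have := hf p hp
  have sq : CommSq i (i ≫ p) p (𝟙 D) := ⟨by simp⟩
  exact ⟨Z, i, sq.lift, p, hi, sq.fac_left, rfl, sq.fac_right⟩

end SmallObjectArgument

/-! ### Pure morphisms in locally finitely presentable categories -/

section Pure

variable {C : Type u} [Category.{v} C]

attribute [local instance] Cardinal.fact_isRegular_aleph0

lemma IsPure.of_comp {A B D : C} {f : A ⟶ B} {g : B ⟶ D} (h : IsPure (f ≫ g)) : IsPure f :=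
  fun _ _ hX hY z s t e => h hX hY z s (t ≫ g) (by simp [reassoc_of% e])

lemma IsPure.comp {A B D : C} {f : A ⟶ B} {g : B ⟶ D} (hf : IsPure f) (hg : IsPure g) :
    IsPure (f ≫ g) := fun X Y hX hY z s t e => by
  obtain ⟨d, hd⟩ := hg hX hY z (s ≫ f) t (by simpa using e)
  exact hf hX hY z s d hd.symm

lemma IsPure.of_isSplitMono {A B : C} (f : A ⟶ B) [IsSplitMono f] : IsPure f :=
  fun _ _ _ _ _ s t e => ⟨t ≫ retraction f, by rw [← reassoc_of% e]; simp⟩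

lemma pureMono.of_comp {A B D : C} {f : A ⟶ B} {g : B ⟶ D} (h : pureMono C (f ≫ g)) :
    pureMono C f :=
  have := h.1
  ⟨mono_of_mono f g, h.2.of_comp⟩

lemma pureMono_of_isSplitMono {A B : C} (f : A ⟶ B) [IsSplitMono f] : pureMono C f :=
  ⟨inferInstance, IsPure.of_isSplitMono f⟩

instance : (pureMono C).IsMultiplicative where
  id_mem X := pureMono_of_isSplitMono (𝟙 X)
  comp_mem f g hf hg := by
    have := hf.1
    have := hg.1
    exact ⟨mono_comp f g, hf.2.comp hg.2⟩

instance : (pureMono C).RespectsIso :=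
  MorphismProperty.respectsIso_of_isStableUnderComposition
    (fun _ _ f (_ : IsIso f) => pureMono_of_isSplitMono f)

variable [IsLocallyFinitelyPresentable.{v} C]

/-- Two maps from a finitely presentable object which are identified by a pure morphism factor
through a common finitely presentable object `G`, and purity applies to the coequalizer of the two
maps to `G`. -/
lemma IsPure.mono {A B : C} {f : A ⟶ B} (hf : IsPure f) : Mono f := by
  obtain ⟨P, _, hP⟩ := HasCardinalFilteredGenerator.exists_small_generator C Cardinal.aleph0.{v}
  rw [hP.isStrongGenerator.isSeparating.mono_iff]
  intro G hG a b hab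
  obtain ⟨J, _, _, ⟨p⟩⟩ := hP.exists_colimitsOfShape A
  have hfil : IsFiltered J := isFiltered_of_isCardinalFiltered J Cardinal.aleph0.{v}
  have hGp : IsFinitelyPresentable.{v} G := hP.le_isCardinalPresentable _ hG
  obtain ⟨j₁, a', rfl⟩ := IsFinitelyPresentable.exists_hom_of_isColimit p.isColimit a
  obtain ⟨j₂, b', rfl⟩ := IsFinitelyPresentable.exists_hom_of_isColimit p.isColimit b
  let j := IsFiltered.max j₁ j₂
  let a'' := a' ≫ p.diag.map (IsFiltered.leftToMax j₁ j₂)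
  let b'' := b' ≫ p.diag.map (IsFiltered.rightToMax j₁ j₂)
  have ha : a'' ≫ p.ι.app j = a' ≫ p.ι.app j₁ := by simp [a'', j]
  have hb : b'' ≫ p.ι.app j = b' ≫ p.ι.app j₂ := by simp [b'', j]
  have hX : IsFinitelyPresentable.{v} (p.diag.obj j) :=
    hP.le_isCardinalPresentable _ (p.prop_diag_obj j)
  have hY : IsFinitelyPresentable.{v} (coequalizer a'' b'') := by
    have : ∀ k, IsCardinalPresentable ((parallelPair a'' b'').obj k) Cardinal.aleph0.{v} := by
      rintro (_ | _)
      · exact hGp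
      · exact hX
    refine isCardinalPresentable_of_isColimit _ (colimit.isColimit (parallelPair a'' b''))
      Cardinal.aleph0.{v} ?_
    simp only [hasCardinalLT_aleph0_iff]
    infer_instance
  obtain ⟨d, hd⟩ := hf hX hY (coequalizer.π a'' b'') (p.ι.app j)
    (coequalizer.desc (p.ι.app j ≫ f) (by
      rw [← Category.assoc, ← Category.assoc, ha, hb]
      simpa using hab)) (by simp)
  change a' ≫ p.ι.app j₁ = b' ≫ p.ι.app j₂
  rw [← ha, ← hb, ← hd, coequalizer.condition_assoc]

lemma IsPure.pureMono {A B : C} {f : A ⟶ B} (hf : IsPure f) : pureMono C f := ⟨hf.mono, hf⟩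

instance isStableUnderColimitsOfShape_pureMono (J : Type v) [SmallCategory J] [IsFiltered J] :
    (pureMono C).IsStableUnderColimitsOfShape J where
  condition X₁ X₂ c₁ c₂ h₁ h₂ f hf φ hφ := by
    refine IsPure.pureMono fun X Y hX hY z s t e => ?_
    obtain ⟨j₁, s', rfl⟩ := IsFinitelyPresentable.exists_hom_of_isColimit h₁ s
    obtain ⟨j₂, t', rfl⟩ := IsFinitelyPresentable.exists_hom_of_isColimit h₂ t
    obtain ⟨k, u, v, huv⟩ := IsFinitelyPresentable.exists_eq_of_isColimit h₂
      (s' ≫ f.app j₁) (z ≫ t') (by simpa [hφ] using e)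
    obtain ⟨d, hd⟩ := (hf k).2 hX hY z (s' ≫ X₁.map u) (t' ≫ X₂.map v) (by simpa using huv)
    exact ⟨d ≫ c₁.ι.app k, by rw [reassoc_of% hd]; simp⟩

instance : MorphismProperty.IsStableUnderFilteredColimits.{v, v} (pureMono C) where
  isStableUnderColimitsOfShape J _ _ := isStableUnderColimitsOfShape_pureMono J

lemma cof_le_pureMono {W : MorphismProperty C} (hW : W.pushouts ≤ pureMono C) :
    cof W ≤ pureMono C := by
  rintro A D f ⟨X, g, i, r, hg, hi, hr, hir⟩
  have := (MorphismProperty.transfiniteCompositions_le_iff.{v} (Q := pureMono C)).2 hW g hg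
  rw [← hi] at this
  exact this.of_comp

end Pure

/-! ### The category of arrows is locally presentable -/

section Arrow

open Opposite

variable {C : Type u} [Category.{v} C] {κ : Cardinal.{v}} [Fact κ.IsRegular]

instance [HasColimitsOfSize.{v, v} C] : HasColimitsOfSize.{v, v} (Arrow C) where

/-- Maps from an identity arrow are maps to the source. -/
def leftFuncCompCoyonedaIso (G : C) :
    Arrow.leftFunc ⋙ coyoneda.obj (op G) ≅ coyoneda.obj (op (Arrow.mk (𝟙 G))) :=
  NatIso.ofComponents (fun f => Equiv.toIso
    { toFun := fun (a : G ⟶ f.left) => Arrow.homMk a (a ≫ f.hom) (by simp)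
      invFun := fun a => a.left
      left_inv := fun a => rfl
      right_inv := fun a => Arrow.hom_ext _ _ rfl (by simp) })
    (fun {X Y} g => by
      ext a
      refine Arrow.hom_ext _ _ rfl ?_
      exact (Category.assoc _ _ _).trans
        ((a ≫= Arrow.w g).trans (Category.assoc _ _ _).symm))

/-- Maps from an arrow with initial source are maps to the target. -/
noncomputable def rightFuncCompCoyonedaIso [HasInitial C] (G : C) :
    Arrow.rightFunc ⋙ coyoneda.obj (op G) ≅ coyoneda.obj (op (Arrow.mk (initial.to G))) :=
  NatIso.ofComponents (fun f => Equiv.toIso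
    { toFun := fun (a : G ⟶ f.right) => Arrow.homMk (initial.to _) a
        (initialIsInitial.hom_ext _ _)
      invFun := fun a => a.right
      left_inv := fun a => rfl
      right_inv := fun a => Arrow.hom_ext _ _ (initialIsInitial.hom_ext _ _) rfl })
    (fun g => by
      ext a
      exact Arrow.hom_ext _ _ (initialIsInitial.hom_ext _ _) rfl)

variable [HasColimitsOfSize.{v, v} C]

instance : (Arrow.leftFunc : Arrow C ⥤ C).IsCardinalAccessible κ where
instance : (Arrow.rightFunc : Arrow C ⥤ C).IsCardinalAccessible κ where

lemma isCardinalPresentable_arrowMk_id (G : C) [IsCardinalPresentable G κ] :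
    IsCardinalPresentable (Arrow.mk (𝟙 G)) κ :=
  Functor.isCardinalAccessible_of_natIso (leftFuncCompCoyonedaIso G) κ

lemma isCardinalPresentable_arrowMk_initial [HasInitial C] (G : C) [IsCardinalPresentable G κ] :
    IsCardinalPresentable (Arrow.mk (initial.to G)) κ :=
  Functor.isCardinalAccessible_of_natIso (rightFuncCompCoyonedaIso G) κ

/-- The strong generator of the category of arrows given by the identities `G ⟶ G` and the
initial maps `⊥ ⟶ G`, where `G` runs through a strong generator of `C`. -/
noncomputable def arrowGenerator [HasInitial C] (P : ObjectProperty C) :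
    ObjectProperty (Arrow C) :=
  ObjectProperty.ofObj (Sum.elim (fun G : Subtype P => Arrow.mk (𝟙 G.1))
    (fun G : Subtype P => Arrow.mk (initial.to G.1)))

instance [HasInitial C] (P : ObjectProperty C) [ObjectProperty.Small.{v} P] :
    ObjectProperty.Small.{v} (arrowGenerator P) := by
  have : Small.{v} (Subtype P) := inferInstanceAs (ObjectProperty.Small.{v} P)
  unfold arrowGenerator
  infer_instance

omit [HasColimitsOfSize.{v, v} C] in
lemma isStrongGenerator_arrowGenerator [HasInitial C] {P : ObjectProperty C}
    (hP : P.IsStrongGenerator) : (arrowGenerator P).IsStrongGenerator := by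
  have hl (G) (hG : P G) : arrowGenerator P (Arrow.mk (𝟙 G)) :=
    ObjectProperty.ofObj_apply (Sum.elim (fun G : Subtype P => Arrow.mk (𝟙 G.1))
      (fun G : Subtype P => Arrow.mk (initial.to G.1))) (Sum.inl ⟨G, hG⟩)
  have hr (G) (hG : P G) : arrowGenerator P (Arrow.mk (initial.to G)) :=
    ObjectProperty.ofObj_apply (Sum.elim (fun G : Subtype P => Arrow.mk (𝟙 G.1))
      (fun G : Subtype P => Arrow.mk (initial.to G.1))) (Sum.inr ⟨G, hG⟩)
  rw [ObjectProperty.isStrongGenerator_iff]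
  refine ⟨fun X Y f g h => ?_, fun X Y i _ hi => ?_⟩
  · ext
    · refine hP.isSeparating _ _ fun G hG a => ?_
      exact congrArg CommaMorphism.left
        (h _ (hl G hG) (Arrow.homMk a (a ≫ X.hom) (by simp)))
    · refine hP.isSeparating _ _ fun G hG a => ?_
      exact congrArg CommaMorphism.right
        (h _ (hr G hG) (Arrow.homMk (initial.to _) a (initialIsInitial.hom_ext _ _)))
  · have hml : Mono i.left := by
      rw [hP.isSeparating.mono_iff]
      intro G hG a b hab
      have := (cancel_mono i).1 (show
        (Arrow.homMk a (a ≫ X.hom) (by simp) : Arrow.mk (𝟙 G) ⟶ X) ≫ i =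
        (Arrow.homMk b (b ≫ X.hom) (by simp) : Arrow.mk (𝟙 G) ⟶ X) ≫ i by
          apply Arrow.hom_ext
          · exact hab
          · have := hab =≫ Y.hom
            simpa using this)
      exact congrArg CommaMorphism.left this
    have hmr : Mono i.right := by
      rw [hP.isSeparating.mono_iff]
      intro G hG a b hab
      have := (cancel_mono i).1 (show
        (Arrow.homMk (initial.to _) a (initialIsInitial.hom_ext _ _) :
          Arrow.mk (initial.to G) ⟶ X) ≫ i =
        (Arrow.homMk (initial.to _) b (initialIsInitial.hom_ext _ _) :
          Arrow.mk (initial.to G) ⟶ X) ≫ i by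
          apply Arrow.hom_ext
          · exact initialIsInitial.hom_ext _ _
          · exact hab)
      exact congrArg CommaMorphism.right this
    have : IsIso i.left := hP.isIso_of_mono _ fun G hG a => by
      obtain ⟨b, hb⟩ := hi _ (hl G hG) (Arrow.homMk a (a ≫ Y.hom) (by simp))
      exact ⟨b.left, congrArg CommaMorphism.left hb⟩
    have : IsIso i.right := hP.isIso_of_mono _ fun G hG a => by
      obtain ⟨b, hb⟩ := hi _ (hr G hG)
        (Arrow.homMk (initial.to _) a (initialIsInitial.hom_ext _ _))
      exact ⟨b.right, congrArg CommaMorphism.right hb⟩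
    exact Arrow.isIso_of_isIso_left_of_isIso_right i

lemma arrowGenerator_le [HasInitial C] {P : ObjectProperty C} (hP : P ≤ isCardinalPresentable C κ) :
    arrowGenerator P ≤ isCardinalPresentable (Arrow C) κ := by
  rintro _ ⟨⟨G, hG⟩ | ⟨G, hG⟩⟩
  · have : IsCardinalPresentable G κ := hP _ hG
    exact isCardinalPresentable_arrowMk_id G
  · have : IsCardinalPresentable G κ := hP _ hG
    exact isCardinalPresentable_arrowMk_initial G

omit [HasColimitsOfSize.{v, v} C]

variable [IsCardinalLocallyPresentable C κ]

variable (C κ) in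
lemma isCardinalLocallyPresentable_arrow : IsCardinalLocallyPresentable (Arrow C) κ := by
  obtain ⟨P, _, hP⟩ := HasCardinalFilteredGenerator.exists_small_generator C κ
  exact (IsCardinalLocallyPresentable.iff_exists_isStrongGenerator (Arrow C) κ).2
    ⟨arrowGenerator P, inferInstance, isStrongGenerator_arrowGenerator hP.isStrongGenerator,
      arrowGenerator_le hP.le_isCardinalPresentable⟩

lemma isCardinalPresentable_left_right (f : Arrow C) [hf : IsCardinalPresentable f κ] :
    IsCardinalPresentable f.left κ ∧ IsCardinalPresentable f.right κ := by
  obtain ⟨P, _, hP⟩ := HasCardinalFilteredGenerator.exists_small_generator C κ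
  have h := IsStrongGenerator.colimitsCardinalClosure_eq_isCardinalPresentable
    (isStrongGenerator_arrowGenerator hP.isStrongGenerator)
    (arrowGenerator_le hP.le_isCardinalPresentable)
  let Q : ObjectProperty (Arrow C) := (isCardinalPresentable C κ).inverseImage Arrow.leftFunc ⊓
    (isCardinalPresentable C κ).inverseImage Arrow.rightFunc
  have hQ : arrowGenerator P ≤ Q := by
    have hbot : IsCardinalPresentable (⊥_ C) κ := by
      have : ∀ k, IsCardinalPresentable ((Functor.empty.{0} C).obj k) κ := by rintro ⟨⟨⟩⟩
      refine isCardinalPresentable_of_isColimit _ initialIsInitial κ ?_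
      refine .of_le ?_ (Cardinal.IsRegular.aleph0_le Fact.out)
      simp only [hasCardinalLT_aleph0_iff]
      infer_instance
    rintro _ ⟨⟨G, hG⟩ | ⟨G, hG⟩⟩
    · exact ⟨hP.le_isCardinalPresentable _ hG, hP.le_isCardinalPresentable _ hG⟩
    · exact ⟨hbot, hP.le_isCardinalPresentable _ hG⟩
  have : isCardinalPresentable (Arrow C) κ ≤ Q := by
    rw [h]
    refine ObjectProperty.colimitsCardinalClosure_le _ κ (fun J _ hJ => ?_) hQ
    have := isClosedUnderColimitsOfShape_isCardinalPresentable C hJ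
    have h₁ : ((isCardinalPresentable C κ).inverseImage
      (Arrow.leftFunc : Arrow C ⥤ C)).IsClosedUnderColimitsOfShape J := inferInstance
    have h₂ : ((isCardinalPresentable C κ).inverseImage
      (Arrow.rightFunc : Arrow C ⥤ C)).IsClosedUnderColimitsOfShape J := inferInstance
    exact ⟨fun X hX =>
      ⟨h₁.colimitsOfShape_le _ (ObjectProperty.colimitsOfShape_monotone J inf_le_left _ hX),
      h₂.colimitsOfShape_le _ (ObjectProperty.colimitsOfShape_monotone J inf_le_right _ hX)⟩⟩
  exact this f hf

/-- In a locally `κ`-presentable category, every morphism is a `κ`-filtered colimit of morphisms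
between `κ`-presentable objects. -/
lemma exists_presentation_of_hom (κ : Cardinal.{v}) [Fact κ.IsRegular]
    [IsCardinalLocallyPresentable C κ] {A B : C} (f : A ⟶ B) :
    ∃ (J : Type v) (_ : SmallCategory J) (_ : IsCardinalFiltered J κ) (D₁ D₂ : J ⥤ C)
      (φ : D₁ ⟶ D₂) (s₁ : D₁ ⟶ (Functor.const J).obj A) (s₂ : D₂ ⟶ (Functor.const J).obj B)
      (_ : IsColimit (Cocone.mk A s₁)) (_ : IsColimit (Cocone.mk B s₂)),
      φ ≫ s₂ = s₁ ≫ (Functor.const J).map f ∧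
      (∀ j, IsCardinalPresentable (D₁.obj j) κ) ∧ ∀ j, IsCardinalPresentable (D₂.obj j) κ := by
  have := isCardinalLocallyPresentable_arrow C κ
  obtain ⟨P, _, hP⟩ := HasCardinalFilteredGenerator.exists_small_generator (Arrow C) κ
  obtain ⟨J, _, _, ⟨p⟩⟩ := hP.exists_colimitsOfShape (Arrow.mk f)
  have h (j) : IsCardinalPresentable (p.diag.obj j) κ :=
    hP.le_isCardinalPresentable _ (p.prop_diag_obj j)
  refine ⟨J, inferInstance, inferInstance, p.diag ⋙ Arrow.leftFunc, p.diag ⋙ Arrow.rightFunc,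
    Functor.whiskerLeft p.diag Arrow.leftToRight, Functor.whiskerRight p.ι Arrow.leftFunc,
    Functor.whiskerRight p.ι Arrow.rightFunc,
    isColimitOfPreserves Arrow.leftFunc p.isColimit,
    isColimitOfPreserves Arrow.rightFunc p.isColimit, ?_,
    fun j => (isCardinalPresentable_left_right _).1,
    fun j => (isCardinalPresentable_left_right _).2⟩
  ext j
  exact (Arrow.w (p.ι.app j)).symm

end Arrow

/-! ### Morphisms as filtered colimits of pushouts of small morphisms -/

section Pushouts

variable {C : Type u} [Category.{v} C]

/-- Pushouts commute with colimits: a pushout of colimits of `K₀`, `K₁`, `K₂` is a colimit of the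
pushout `P` of these diagrams. -/
noncomputable def isColimitOfIsPushout {J : Type u'} [Category.{v'} J] {K₀ K₁ K₂ P : J ⥤ C}
    {a : K₀ ⟶ K₁} {b : K₀ ⟶ K₂} {i₁ : K₁ ⟶ P} {i₂ : K₂ ⟶ P}
    (h : ∀ j, IsPushout (a.app j) (b.app j) (i₁.app j) (i₂.app j))
    {c₀ : Cocone K₀} {c₁ : Cocone K₁} {c₂ : Cocone K₂} (h₀ : IsColimit c₀) (h₁ : IsColimit c₁)
    (h₂ : IsColimit c₂) {x : c₀.pt ⟶ c₁.pt} {y : c₀.pt ⟶ c₂.pt} {c : Cocone P}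
    {k₁ : c₁.pt ⟶ c.pt} {k₂ : c₂.pt ⟶ c.pt} (hc : IsPushout x y k₁ k₂)
    (hx : ∀ j, c₀.ι.app j ≫ x = a.app j ≫ c₁.ι.app j)
    (hy : ∀ j, c₀.ι.app j ≫ y = b.app j ≫ c₂.ι.app j)
    (hi₁ : ∀ j, i₁.app j ≫ c.ι.app j = c₁.ι.app j ≫ k₁)
    (hi₂ : ∀ j, i₂.app j ≫ c.ι.app j = c₂.ι.app j ≫ k₂) : IsColimit c :=
  have aux (s : Cocone P) : x ≫ h₁.desc ((Cocone.precompose i₁).obj s) =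
      y ≫ h₂.desc ((Cocone.precompose i₂).obj s) :=
    h₀.hom_ext fun j => by
      rw [reassoc_of% (hx j), reassoc_of% (hy j), h₁.fac, h₂.fac]
      simp [(h j).w_assoc]
  { desc := fun s => hc.desc (h₁.desc ((Cocone.precompose i₁).obj s))
      (h₂.desc ((Cocone.precompose i₂).obj s)) (aux s)
    fac := fun s j => (h j).hom_ext
      (by rw [reassoc_of% (hi₁ j), hc.inl_desc, h₁.fac]; simp)
      (by rw [reassoc_of% (hi₂ j), hc.inr_desc, h₂.fac]; simp)
    uniq := fun s m hm => hc.hom_ext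
      (h₁.hom_ext fun j => by
        rw [hc.inl_desc, h₁.fac, ← reassoc_of% (hi₁ j), hm]
        simp)
      (h₂.hom_ext fun j => by
        rw [hc.inr_desc, h₂.fac, ← reassoc_of% (hi₂ j), hm]
        simp) }

/-- In a locally `κ`-presentable category, every morphism out of `A` is, under `A`, a `κ`-filtered
colimit of pushouts of morphisms between `κ`-presentable objects. -/
lemma exists_presentation_under (κ : Cardinal.{v}) [Fact κ.IsRegular]
    [IsCardinalLocallyPresentable C κ] {A B : C} (f : A ⟶ B) :
    ∃ (J : Type v) (_ : SmallCategory J) (_ : IsCardinalFiltered J κ) (D₁ D₂ P : J ⥤ C)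
      (φ : D₁ ⟶ D₂) (s₁ : D₁ ⟶ (Functor.const J).obj A) (s₂ : D₂ ⟶ (Functor.const J).obj B)
      (_ : IsColimit (Cocone.mk A s₁))
      (t : (Functor.const J).obj A ⟶ P) (i : D₂ ⟶ P) (s : P ⟶ (Functor.const J).obj B)
      (_ : IsColimit (Cocone.mk B s)),
      (∀ j, IsCardinalPresentable (D₁.obj j) κ) ∧ (∀ j, IsCardinalPresentable (D₂.obj j) κ) ∧
      (∀ j, IsPushout (s₁.app j) (φ.app j) (t.app j) (i.app j)) ∧
      (∀ j, t.app j ≫ s.app j = f) ∧ (∀ j, i.app j ≫ s.app j = s₂.app j) := by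
  obtain ⟨J, _, _, D₁, D₂, φ, s₁, s₂, h₁, h₂, hφ, hD₁, hD₂⟩ := exists_presentation_of_hom κ f
  have : IsFiltered J := isFiltered_of_isCardinalFiltered J κ
  have : IsConnected J := IsFiltered.isConnected J
  have hpo := IsPushout.of_hasPushout s₁ φ
  have hpo' (j : J) := hpo.map ((evaluation J C).obj j)
  let s : pushout s₁ φ ⟶ (Functor.const J).obj B :=
    pushout.desc ((Functor.const J).map f) s₂ hφ.symm
  have hs₁ (j : J) : (pushout.inl s₁ φ).app j ≫ s.app j = f := by
    rw [← NatTrans.comp_app, pushout.inl_desc]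
    rfl
  have hs₂ (j : J) : (pushout.inr s₁ φ).app j ≫ s.app j = s₂.app j := by
    rw [← NatTrans.comp_app, pushout.inr_desc]
  have hc : IsPushout (𝟙 A) f f (𝟙 B) := IsPushout.of_horiz_isIso ⟨by simp⟩
  refine ⟨J, inferInstance, inferInstance, D₁, D₂, pushout s₁ φ, φ, s₁, s₂, h₁, pushout.inl _ _,
    pushout.inr _ _, s, ?_, hD₁, hD₂, hpo', hs₁, hs₂⟩
  refine isColimitOfIsPushout (c := Cocone.mk B s) hpo' h₁ (isColimitConstCocone J A) h₂ hc
    ?_ ?_ ?_ ?_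
  · intro j
    simp
  · intro j
    exact (congr_app hφ j).symm
  · intro j
    exact (hs₁ j).trans (Category.id_comp f).symm
  · intro j
    simpa using hs₂ j

end Pushouts

section Pure

variable {C : Type u} [Category.{v} C]

variable (C) in
/-- The class of split monomorphisms. -/
def splitMono : MorphismProperty C := fun _ _ f => IsSplitMono f

instance : (splitMono C).IsStableUnderCobaseChange where
  of_isPushout {A A' B B' f g f' g'} sq hg := by
    have : IsSplitMono f := hg
    exact IsSplitMono.mk' ⟨sq.desc (𝟙 _) (retraction f ≫ g) (by simp), by simp⟩

attribute [local instance] Cardinal.fact_isRegular_aleph0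

variable [IsLocallyFinitelyPresentable.{v} C]

/-- The pure morphisms are the filtered colimits of split monomorphisms. -/
lemma pureMono_eq_ind_splitMono : pureMono C = MorphismProperty.ind.{v} (splitMono C) := by
  ext A B f
  constructor
  · rintro ⟨_, hf⟩
    obtain ⟨J, _, _, D₁, D₂, P, φ, s₁, s₂, -, t, i, s, hs, hD₁, hD₂, hpo, hts, his⟩ :=
      exists_presentation_under Cardinal.aleph0.{v} f
    refine ⟨J, inferInstance, isFiltered_of_isCardinalFiltered J Cardinal.aleph0.{v}, P, t, s, hs,
      fun j => ⟨?_, hts j⟩⟩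
    obtain ⟨d, hd⟩ := hf (hD₁ j) (hD₂ j) (φ.app j) (s₁.app j) (s₂.app j)
      (by rw [← hts j, ← his j, (hpo j).w_assoc])
    exact IsSplitMono.mk' ⟨(hpo j).desc (𝟙 A) d (by simpa using hd.symm), by simp⟩
  · rintro ⟨J, _, _, P, t, s, hs, h⟩
    refine IsPure.pureMono fun X Y hX hY z a b e => ?_
    obtain ⟨j, b', rfl⟩ := IsFinitelyPresentable.exists_hom_of_isColimit hs b
    have hj := (h j).2
    obtain ⟨k, u, v, hu⟩ := IsFinitelyPresentable.exists_eq_of_isColimit hs (a ≫ t.app j) (z ≫ b')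
      (by simpa [hj] using e)
    have htk : t.app j ≫ P.map u = t.app k := by simpa using (t.naturality u).symm
    have : IsSplitMono (t.app k) := (h k).1
    refine ⟨b' ≫ P.map v ≫ retraction (t.app k), ?_⟩
    rw [← Category.assoc, ← Category.assoc, ← hu, Category.assoc a, htk]
    simp

instance : (pureMono C).IsStableUnderCobaseChange := by
  rw [pureMono_eq_ind_splitMono]
  infer_instance

end Pure

section Presentable

variable {C : Type u} [Category.{v} C]

/-- Let `f : A ⟶ B` be a retract under `A` of a pushout `t : A ⟶ P` of `φ : X ⟶ Y`, with
inclusion `r` and retraction `s`. If `X ⟶ A` factors through `D ⟶ A` and if the restriction to `Y`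
of the idempotent `s ≫ r` of `P` factors through the pushout `Q` of `φ` along `X ⟶ D`, then `f` is
a pushout of a morphism from `D` to a quotient of `Q`. -/
lemma isPushout_coequalizer_desc [HasCoequalizers C] {A B D P Q X Y : C} {a : X ⟶ A} {φ : X ⟶ Y}
    {t : A ⟶ P} {i : Y ⟶ P} (sq : IsPushout a φ t i) {m : X ⟶ D} {a' : D ⟶ A} (ha : m ≫ a' = a)
    {p : D ⟶ Q} {q : Y ⟶ Q} (sq' : IsPushout m φ p q) {w : Q ⟶ P} (hp : p ≫ w = a' ≫ t)
    (hq : q ≫ w = i) {f : A ⟶ B} {r : B ⟶ P} {s : P ⟶ B} (hrs : r ≫ s = 𝟙 B) (hts : t ≫ s = f)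
    (hfr : f ≫ r = t) {y : Y ⟶ Q} (hy : y ≫ w = i ≫ s ≫ r) :
    IsPushout a' (p ≫ coequalizer.π y q) f
      (coequalizer.desc (w ≫ s)
        (by rw [reassoc_of% hy, hrs, reassoc_of% hq, Category.comp_id])) := by
  have aux (Z : C) (α : A ⟶ Z) (β : coequalizer y q ⟶ Z)
      (h : a' ≫ α = (p ≫ coequalizer.π y q) ≫ β) :
      ∃ g : P ⟶ Z, t ≫ g = α ∧ i ≫ g = q ≫ coequalizer.π y q ≫ β ∧
        w ≫ g = coequalizer.π y q ≫ β := by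
    have e : a ≫ α = φ ≫ q ≫ coequalizer.π y q ≫ β := by
      rw [← ha, Category.assoc, h, Category.assoc, sq'.w_assoc]
    refine ⟨sq.desc α (q ≫ coequalizer.π y q ≫ β) e, by simp, by simp, sq'.hom_ext ?_ ?_⟩
    · rw [reassoc_of% hp, sq.inl_desc, h, Category.assoc]
    · rw [reassoc_of% hq, sq.inr_desc]
  choose g hg₁ hg₂ hg₃ using aux
  refine ⟨⟨?_⟩, ⟨PushoutCocone.IsColimit.mk _
    (fun c => r ≫ g _ c.inl c.inr c.condition) ?_ ?_ ?_⟩⟩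
  · rw [Category.assoc, coequalizer.π_desc, reassoc_of% hp, hts]
  · intro c
    rw [reassoc_of% hfr, hg₁]
  · intro c
    refine coequalizer.hom_ext (sq'.hom_ext ?_ ?_)
    · rw [coequalizer.π_desc_assoc, Category.assoc, reassoc_of% hp, reassoc_of% hts,
        reassoc_of% hfr, hg₁]
      simpa using c.condition
    · rw [coequalizer.π_desc_assoc, Category.assoc, reassoc_of% hq, ← reassoc_of% hy, hg₃,
        coequalizer.condition_assoc]
  · intro c b hb₁ hb₂
    have : s ≫ b = g _ c.inl c.inr c.condition := sq.hom_ext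
      (by rw [reassoc_of% hts, hg₁, hb₁])
      (by rw [hg₂, ← hb₂, coequalizer.π_desc_assoc, Category.assoc, reassoc_of% hq])
    rw [← this, reassoc_of% hrs]

variable {κ : Cardinal.{v}} [Fact κ.IsRegular]

lemma isCardinalPresentable_colimit_of_finCategory [HasFiniteColimits C] {K : Type}
    [SmallCategory K] [FinCategory K] (F : K ⥤ C)
    (hF : ∀ x, IsCardinalPresentable (F.obj x) κ) : IsCardinalPresentable (colimit F) κ := by
  refine isCardinalPresentable_of_isColimit _ (colimit.isColimit F) κ ?_
  refine .of_le ?_ (Cardinal.IsRegular.aleph0_le Fact.out)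
  simp only [hasCardinalLT_aleph0_iff]
  infer_instance

/-- A `κ`-presentable morphism is a pushout of a morphism between `κ`-presentable objects. -/
lemma exists_isPushout_of_isCardinalPresentable [IsCardinalLocallyPresentable C κ] {A B : C}
    (f : A ⟶ B) [IsCardinalPresentable (Under.mk f) κ] :
    ∃ (X Y : C) (f₀ : X ⟶ Y) (a : X ⟶ A) (b : Y ⟶ B), IsCardinalPresentable X κ ∧
      IsCardinalPresentable Y κ ∧ IsPushout a f₀ f b := by
  obtain ⟨J, _, _, D₁, D₂, P, φ, s₁, s₂, h₁, t, i, s, hs, hD₁, hD₂, hpo, hts, his⟩ :=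
    exists_presentation_under κ f
  have : IsFiltered J := isFiltered_of_isCardinalFiltered J κ
  have : Nonempty J := IsFiltered.nonempty
  -- `f` is a retract of `A ⟶ P.obj j`, by presentability
  obtain ⟨j, r, hr⟩ := IsCardinalPresentable.exists_hom_of_isColimit κ
    (Under.isColimitLiftCocone P t _ f hts hs) (𝟙 (Under.mk f))
  have hrs : r.right ≫ s.app j = 𝟙 B := congrArg (fun g => g.right) hr
  have hfr : f ≫ r.right = t.app j := Under.w r
  -- the idempotent of `P.obj j` is determined by a map from the `κ`-presentable object `D₂.obj j`
  -- to `P.obj j`, which is the colimit of the pushouts of `φ.app j` along `D₁.obj j ⟶ D₁.obj k`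
  let a : (Functor.const (Under j)).obj (D₁.obj j) ⟶ Under.forget j ⋙ D₁ :=
    { app := fun k => D₁.map k.hom
      naturality := fun k l g => by
        have := Under.w g
        simp [← Functor.map_comp] }
  let b : (Functor.const (Under j)).obj (D₁.obj j) ⟶ (Functor.const (Under j)).obj (D₂.obj j) :=
    (Functor.const (Under j)).map (φ.app j)
  have hQ (k : Under j) := (IsPushout.of_hasPushout a b).map ((evaluation _ C).obj k)
  have hs₁ (k : Under j) : D₁.map k.hom ≫ s₁.app k.right = s₁.app j := by
    simp
  let w : pushout a b ⟶ (Functor.const (Under j)).obj (P.obj j) :=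
    pushout.desc (Functor.whiskerLeft (Under.forget j) s₁ ≫ (Functor.const _).map (t.app j))
      ((Functor.const _).map (i.app j)) (by
        ext k
        have := (hpo j).w
        rw [← hs₁ k] at this
        simpa [a, b] using this)
  have hw₁ (k : Under j) : (pushout.inl a b).app k ≫ w.app k = s₁.app k.right ≫ t.app j := by
    rw [← NatTrans.comp_app, pushout.inl_desc]
    rfl
  have hw₂ (k : Under j) : (pushout.inr a b).app k ≫ w.app k = i.app j := by
    rw [← NatTrans.comp_app, pushout.inr_desc]
    rfl
  have : IsFiltered (Under j) := isFiltered_of_isCardinalFiltered _ κ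
  have : IsConnected (Under j) := IsFiltered.isConnected _
  have hw : IsColimit (Cocone.mk (P.obj j) w) :=
    isColimitOfIsPushout (c := Cocone.mk (P.obj j) w) hQ (isColimitConstCocone _ _)
      ((Functor.Final.isColimitWhiskerEquiv (Under.forget j) _).symm h₁)
      (isColimitConstCocone _ _) (hpo j)
      (a := a) (b := b) (fun k => (Category.id_comp _).trans (hs₁ k).symm)
      (fun k => (Category.id_comp _).trans (Category.comp_id (φ.app j)).symm) hw₁
      (fun k => (hw₂ k).trans (Category.id_comp _).symm)
  have := hD₁ j
  have := hD₂ j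
  obtain ⟨k, y, hy⟩ := IsCardinalPresentable.exists_hom_of_isColimit κ hw
    (i.app j ≫ s.app j ≫ r.right)
  have hQk : IsCardinalPresentable ((pushout a b).obj k) κ := by
    refine @isCardinalPresentable_of_iso _ _ _ _ (hQ k).isoPushout.symm κ _
      (isCardinalPresentable_colimit_of_finCategory _ ?_)
    rintro (_ | _ | _)
    · exact hD₁ j
    · exact hD₁ k.right
    · exact hD₂ j
  exact ⟨_, _, _, _, _, hD₁ k.right,
    isCardinalPresentable_colimit_of_finCategory _ (by rintro (_ | _); exacts [hD₂ j, hQk]),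
    isPushout_coequalizer_desc (hpo j) (hs₁ k) (hQ k) (hw₁ k) (hw₂ k) hrs (hts j) hfr hy⟩

/-- A pushout of a morphism between `κ`-presentable objects is a `κ`-presentable morphism. -/
lemma isCardinalPresentable_underMk_of_isPushout {A B X Y : C} {a : X ⟶ A} {f₀ : X ⟶ Y}
    {f : A ⟶ B} {b : Y ⟶ B} (sq : IsPushout a f₀ f b) [IsCardinalPresentable X κ]
    [IsCardinalPresentable Y κ] : IsCardinalPresentable (Under.mk f) κ where
  preservesColimitOfShape J _ _ := ⟨fun {F} => ⟨fun {c} hc => ⟨by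
    have : IsFiltered J := isFiltered_of_isCardinalFiltered J κ
    have hc' := isColimitOfPreserves (Under.forget A) hc
    have hsurj {Z : C} [IsCardinalPresentable Z κ] (g : Z ⟶ c.pt.right) :
        ∃ (j : J) (y : Z ⟶ (F.obj j).right), y ≫ (c.ι.app j).right = g :=
      IsCardinalPresentable.exists_hom_of_isColimit κ hc' g
    have hinj {Z : C} [IsCardinalPresentable Z κ] {j : J} (y₁ y₂ : Z ⟶ (F.obj j).right)
        (h : y₁ ≫ (c.ι.app j).right = y₂ ≫ (c.ι.app j).right) :
        ∃ (k : J) (u : j ⟶ k), y₁ ≫ (F.map u).right = y₂ ≫ (F.map u).right :=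
      IsCardinalPresentable.exists_eq_of_isColimit' κ hc' y₁ y₂ h
    have hι (j : J) : (F.obj j).hom ≫ (c.ι.app j).right = c.pt.hom := Under.w (c.ι.app j)
    have hF {j k : J} (u : j ⟶ k) : (F.obj j).hom ≫ (F.map u).right = (F.obj k).hom :=
      Under.w (F.map u)
    refine Types.FilteredColimit.isColimitOf' _ _ (fun (g : Under.mk f ⟶ c.pt) => ?_)
      (fun j (g₁ : Under.mk f ⟶ F.obj j) (g₂ : Under.mk f ⟶ F.obj j)
        (h : g₁ ≫ c.ι.app j = g₂ ≫ c.ι.app j) => ?_)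
    · have hg : f ≫ g.right = c.pt.hom := Under.w g
      obtain ⟨j, y, hy⟩ := hsurj (b ≫ g.right)
      obtain ⟨k, u, hu⟩ := hinj (f₀ ≫ y) (a ≫ (F.obj j).hom) (by
        rw [Category.assoc, Category.assoc, hy, hι, ← sq.w_assoc, hg])
      rw [Category.assoc, Category.assoc, hF] at hu
      refine ⟨k, Under.homMk (sq.desc (F.obj k).hom (y ≫ (F.map u).right) hu.symm)
        (sq.inl_desc _ _ _), Under.UnderMorphism.ext (sq.hom_ext ?_ ?_)⟩
      · change f ≫ g.right = f ≫ sq.desc _ _ _ ≫ (c.ι.app k).right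
        rw [sq.inl_desc_assoc, hg, hι]
      · change b ≫ g.right = b ≫ sq.desc _ _ _ ≫ (c.ι.app k).right
        rw [sq.inr_desc_assoc, ← hy, ← c.w u, Category.assoc]
        rfl
    · obtain ⟨k, u, hu⟩ := hinj (b ≫ g₁.right) (b ≫ g₂.right) (by
        rw [Category.assoc, Category.assoc]
        exact b ≫= congrArg (fun g => g.right) h)
      refine ⟨k, u, Under.UnderMorphism.ext (sq.hom_ext ?_ ?_)⟩
      · exact (Under.w (g₁ ≫ F.map u)).trans (Under.w (g₂ ≫ F.map u)).symm
      · simpa using hu⟩⟩⟩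

end Presentable

/-! ### Sets closed under small families of operations -/

section Closure

open Cardinal FirstOrder.Language

/-- The function symbols of the theory of a set with a point, a binary operation and unary
operations indexed by `E`. -/
inductive OpSymbol (E : Type v) : ℕ → Type v
  | point : OpSymbol E 0
  | unary (e : E) : OpSymbol E 1
  | binary : OpSymbol E 2

/-- The first-order language with a constant, a binary function symbol and unary function symbols
indexed by `E`. -/
def opLanguage (E : Type v) : FirstOrder.Language.{v, v} := ⟨OpSymbol E, fun _ => PEmpty⟩

/-- The structure given by a point, a binary operation and a family of unary operations. -/
abbrev opStructure {E α : Type v} (a : α) (β : α → α → α) (φ : E → α → α) :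
    (opLanguage E).Structure α where
  funMap {n} (f : OpSymbol E n) := match f with
    | .point => fun _ => a
    | .unary e => fun x => φ e (x 0)
    | .binary => fun x => β (x 0) (x 1)
  RelMap := nofun

lemma mk_sigma_opSymbol_le (E : Type v) : #(Σ n, OpSymbol E n) ≤ #(Option (Option E)) :=
  mk_le_of_surjective (f := fun x : Option (Option E) => match x with
    | none => (⟨_, .point⟩ : Σ n, OpSymbol E n)
    | some none => ⟨_, .binary⟩
    | some (some e) => ⟨_, .unary e⟩) (by
      rintro ⟨_, (_ | e | _)⟩
      exacts [⟨none, rfl⟩, ⟨some (some e), rfl⟩, ⟨some none, rfl⟩])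

/-- The subsets of `α` of cardinality `< δ` which contain `a` and are closed under the binary
operation `β` and the unary operations `φ e`. -/
abbrev ClosedSet {E α : Type v} (a : α) (β : α → α → α) (φ : E → α → α) (δ : Cardinal.{v}) :
    Type v :=
  {S : Set α // #S < δ ∧ a ∈ S ∧ (∀ i ∈ S, ∀ j ∈ S, β i j ∈ S) ∧ ∀ e, ∀ i ∈ S, φ e i ∈ S}

lemma exists_closedSet_superset {E α : Type v} (a : α) (β : α → α → α) (φ : E → α → α)
    {δ : Cardinal.{v}} (hδ : ℵ₀ < δ) (hE : #E < δ) (T : Set α) (hT : #T < δ) :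
    ∃ S : ClosedSet a β φ δ, T ⊆ S.1 := by
  let _ := opStructure a β φ
  let S := Substructure.closure (opLanguage E) T
  refine ⟨⟨(S : Set α), ?_, ?_, ?_, ?_⟩, Substructure.subset_closure⟩
  · have h := Substructure.lift_card_closure_le (L := opLanguage E) (s := T)
    simp only [Cardinal.lift_id] at h
    refine h.trans_lt (max_lt hδ (add_lt_of_lt hδ.le hT ((mk_sigma_opSymbol_le E).trans_lt ?_)))
    rw [mk_option, mk_option]
    have h1 := one_lt_aleph0.trans hδ
    exact add_lt_of_lt hδ.le (add_lt_of_lt hδ.le hE h1) h1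
  · exact S.fun_mem (OpSymbol.point : OpSymbol E 0) ![] (by simp)
  · intro i hi j hj
    exact S.fun_mem (OpSymbol.binary : OpSymbol E 2) ![i, j] (by
      intro k
      fin_cases k
      exacts [hi, hj])
  · intro e i hi
    exact S.fun_mem (OpSymbol.unary e : OpSymbol E 1) ![i] (by
      intro k
      fin_cases k
      exact hi)

lemma isCardinalFiltered_closedSet {E α : Type v} (a : α) (β : α → α → α) (φ : E → α → α)
    {δ : Cardinal.{v}} [Fact δ.IsRegular] (hδ : ℵ₀ < δ) (hE : #E < δ) :
    IsCardinalFiltered (ClosedSet a β φ δ) δ :=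
  isCardinalFiltered_preorder _ _ fun K s hK => by
    obtain ⟨S, hS⟩ := exists_closedSet_superset a β φ hδ hE (⋃ k, (s k).1)
      (card_iUnion_lt_iff_forall_of_isRegular Fact.out hK |>.2 fun k => (s k).2.1)
    exact ⟨S, fun k => (Set.subset_iUnion (fun k => (s k).1) k).trans hS⟩

end Closure

/-! ### Pure subobjects of bounded size -/

section SubColimit

variable {C : Type u} [Category.{v} C] [HasColimitsOfSize.{v, v} C] {α : Type v} [Preorder α]
  (D : α ⥤ C)

/-- The colimit of the restriction of a diagram to a subset of the indexing preordered set. -/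
noncomputable def subColimit (S : Set α) : C :=
  colimit ((Subtype.mono_coe (· ∈ S)).functor ⋙ D)

/-- The inclusion of a member of the restricted diagram in its colimit. -/
noncomputable def subι {S : Set α} {i : α} (hi : i ∈ S) : D.obj i ⟶ subColimit D S :=
  colimit.ι ((Subtype.mono_coe (· ∈ S)).functor ⋙ D) ⟨i, hi⟩

lemma map_subι {S : Set α} {i j : α} (f : i ⟶ j) (hi : i ∈ S) (hj : j ∈ S) :
    D.map f ≫ subι D hj = subι D hi :=
  colimit.w ((Subtype.mono_coe (· ∈ S)).functor ⋙ D) (homOfLE (leOfHom f) :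
    (⟨i, hi⟩ : {x // x ∈ S}) ⟶ ⟨j, hj⟩)

variable {D}

lemma subColimit_hom_ext {S : Set α} {X : C} {f g : subColimit D S ⟶ X}
    (h : ∀ (i : α) (hi : i ∈ S), subι D hi ≫ f = subι D hi ≫ g) : f = g :=
  colimit.hom_ext fun i => h i.1 i.2

/-- The map out of the colimit of a restricted diagram given by a compatible family. -/
noncomputable def subDesc {S : Set α} {X : C} (f : ∀ i ∈ S, D.obj i ⟶ X)
    (hf : ∀ (i j : α) (hi : i ∈ S) (hj : j ∈ S) (u : i ⟶ j), D.map u ≫ f j hj = f i hi) :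
    subColimit D S ⟶ X :=
  colimit.desc ((Subtype.mono_coe (· ∈ S)).functor ⋙ D) (Cocone.mk X
    { app := fun i => f i.1 i.2
      naturality := fun i j u =>
        (hf i.1 j.1 i.2 j.2 (homOfLE (leOfHom u))).trans (Category.comp_id _).symm })

@[simp]
lemma subι_subDesc {S : Set α} {X : C} (f : ∀ i ∈ S, D.obj i ⟶ X)
    (hf : ∀ (i j : α) (hi : i ∈ S) (hj : j ∈ S) (u : i ⟶ j), D.map u ≫ f j hj = f i hi)
    {i : α} (hi : i ∈ S) : subι D hi ≫ subDesc f hf = f i hi :=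
  colimit.ι_desc _ _

@[simp]
lemma subι_subDesc_comp {S : Set α} {X Y : C} (f : ∀ i ∈ S, D.obj i ⟶ X)
    (hf : ∀ (i j : α) (hi : i ∈ S) (hj : j ∈ S) (u : i ⟶ j), D.map u ≫ f j hj = f i hi)
    {i : α} (hi : i ∈ S) (g : X ⟶ Y) : subι D hi ≫ subDesc f hf ≫ g = f i hi ≫ g := by
  rw [← Category.assoc, subι_subDesc]

/-- The map from the colimit over a subset to the colimit over a larger one. -/
noncomputable def subMap {S T : Set α} (h : S ⊆ T) : subColimit D S ⟶ subColimit D T :=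
  subDesc (fun _ hi => subι D (h hi)) (fun _ _ _ _ u => map_subι D u _ _)

lemma subι_subMap {S T : Set α} (h : S ⊆ T) {i : α} (hi : i ∈ S) :
    subι D hi ≫ subMap h = subι D (h hi) :=
  subι_subDesc _ _ _

lemma subι_subMap_comp {S T : Set α} (h : S ⊆ T) {i : α} (hi : i ∈ S) {X : C}
    (f : subColimit D T ⟶ X) : subι D hi ≫ subMap h ≫ f = subι D (h hi) ≫ f :=
  subι_subDesc_comp _ _ _ _

variable (D) in
/-- The colimits of a diagram over the members of an ordered family of subsets. -/
noncomputable def subColimitFunctor {P : Type v} [Preorder P] (U : P → Set α) (hU : Monotone U) :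
    P ⥤ C where
  obj S := subColimit D (U S)
  map f := subMap (hU (leOfHom f))
  map_id S := subColimit_hom_ext fun i hi => by rw [subι_subMap, Category.comp_id]
  map_comp f g := subColimit_hom_ext fun i hi => by
    rw [subι_subMap, subι_subMap_comp, subι_subMap]

/-- The map from the colimit over a subset to the colimit of the whole diagram. -/
noncomputable def subColimitDesc (c : Cocone D) (S : Set α) : subColimit D S ⟶ c.pt :=
  subDesc (fun i _ => c.ι.app i) (fun _ _ _ _ u => c.w u)

@[simp]
lemma subι_subColimitDesc (c : Cocone D) {S : Set α} {i : α} (hi : i ∈ S) :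
    subι D hi ≫ subColimitDesc c S = c.ι.app i :=
  subι_subDesc _ _ _

@[simp]
lemma subι_subColimitDesc_comp (c : Cocone D) {S : Set α} {i : α} (hi : i ∈ S) {X : C}
    (f : c.pt ⟶ X) : subι D hi ≫ subColimitDesc c S ≫ f = c.ι.app i ≫ f :=
  subι_subDesc_comp _ _ _ _

/-- The colimits over the members of a directed cover of the indexing set, as a cocone over
the colimit of the whole diagram. -/
noncomputable def subColimitCocone (c : Cocone D) {P : Type v} [Preorder P]
    (U : P → Set α) (hU : Monotone U) : Cocone (subColimitFunctor D U hU) where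
  pt := c.pt
  ι :=
    { app := fun S => subColimitDesc c (U S)
      naturality := fun _ _ _ => subColimit_hom_ext fun _ hi =>
        (subι_subMap_comp _ hi _).trans ((subι_subColimitDesc c _).trans
          ((subι_subColimitDesc c hi).symm.trans (subι D hi ≫= (Category.comp_id _).symm))) }

section

variable {P : Type v} [Preorder P] {U : P → Set α} {hU : Monotone U}

/-- The legs of a cocone over the colimits of a family of restricted diagrams. -/
noncomputable def subLeg (s : Cocone (subColimitFunctor D U hU)) (S : P) :
    subColimit D (U S) ⟶ s.pt :=
  s.ι.app S

lemma subι_subLeg_of_le (s : Cocone (subColimitFunctor D U hU)) {S T : P} (h : S ≤ T) {i : α}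
    (hi : i ∈ U S) : subι D hi ≫ subLeg s S = subι D (hU h hi) ≫ subLeg s T :=
  (subι D hi ≫= (s.w (homOfLE h)).symm).trans (subι_subMap_comp _ hi (subLeg s T))

lemma subι_subLeg_eq [IsDirectedOrder P] (s : Cocone (subColimitFunctor D U hU)) {S T : P} {i : α}
    (hS : i ∈ U S) (hT : i ∈ U T) : subι D hS ≫ subLeg s S = subι D hT ≫ subLeg s T := by
  obtain ⟨R, hSR, hTR⟩ := exists_ge_ge S T
  rw [subι_subLeg_of_le s hSR, subι_subLeg_of_le s hTR]

end

/-- A colimit is the colimit of the colimits over the members of a directed cover of the indexing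
set. -/
noncomputable def isColimitSubColimitCocone {c : Cocone D} (hc : IsColimit c)
    {P : Type v} [Preorder P] [IsDirectedOrder P] (U : P → Set α) (hU : Monotone U)
    (hcov : ∀ i, ∃ S, i ∈ U S) : IsColimit (subColimitCocone c U hU) :=
  let d (s : Cocone (subColimitFunctor D U hU)) : Cocone D := Cocone.mk s.pt
    { app := fun i => subι D (hcov i).choose_spec ≫ subLeg s (hcov i).choose
      naturality := fun i j f => by
        obtain ⟨R, hiR, hjR⟩ := exists_ge_ge (hcov i).choose (hcov j).choose
        have hi := hU hiR (hcov i).choose_spec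
        have hj := hU hjR (hcov j).choose_spec
        rw [subι_subLeg_eq s _ hi, subι_subLeg_eq s _ hj, ← map_subι D f hi hj]
        simp }
  { desc := fun s => hc.desc (d s)
    fac := fun s S => subColimit_hom_ext fun i hi =>
      (subι_subColimitDesc_comp c hi _).trans
        ((hc.fac (d s) i).trans (subι_subLeg_eq s (hcov i).choose_spec hi))
    uniq := fun s m hm => hc.hom_ext fun i => (hc.fac (d s) i).symm ▸
      ((subι_subColimitDesc_comp c (hcov i).choose_spec m).symm.trans
        (subι D (hcov i).choose_spec ≫= hm (hcov i).choose)) }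

variable (D) in
lemma isCardinalPresentable_subColimit {δ : Cardinal.{v}} [Fact δ.IsRegular]
    [∀ i, IsCardinalPresentable (D.obj i) δ] {S : Set α} (hS : Cardinal.mk S < δ) :
    IsCardinalPresentable (subColimit D S) δ := by
  have (i : {x // x ∈ S}) :
      IsCardinalPresentable (((Subtype.mono_coe (· ∈ S)).functor ⋙ D).obj i) δ :=
    inferInstanceAs (IsCardinalPresentable (D.obj i.1) δ)
  refine isCardinalPresentable_of_isColimit _
    (colimit.isColimit ((Subtype.mono_coe (· ∈ S)).functor ⋙ D)) δ ?_
  rw [hasCardinalLT_iff_cardinal_mk_lt]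
  refine (Cardinal.mk_le_of_injective (f := fun a : Arrow {x // x ∈ S} => (a.left, a.right))
    ?_).trans_lt (by
      rw [← Cardinal.mul_def]
      exact Cardinal.mul_lt_of_lt (Cardinal.IsRegular.aleph0_le Fact.out) hS hS)
  rintro ⟨i, j, f⟩ ⟨i', j', f'⟩ h
  obtain ⟨rfl, rfl⟩ : i = i' ∧ j = j' := by simpa using h
  exact congrArg Arrow.mk (Subsingleton.elim (α := (i ⟶ j)) f f')

lemma exists_of_subColimit {S : Set α} [IsDirectedOrder S] [Nonempty S] {X : C}
    (hX : IsFinitelyPresentable.{v} X) (f : X ⟶ subColimit D S) :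
    ∃ (i : α) (hi : i ∈ S) (x : X ⟶ D.obj i), x ≫ subι D hi = f := by
  have : IsFiltered {x // x ∈ S} := inferInstanceAs (IsFiltered S)
  obtain ⟨i, x, hx⟩ := IsFinitelyPresentable.exists_hom_of_isColimit
    (colimit.isColimit ((Subtype.mono_coe (· ∈ S)).functor ⋙ D)) f
  exact ⟨i.1, i.2, x, hx⟩

end SubColimit

section LowenheimSkolem

open Cardinal

variable (C : Type u) [Category.{v} C] [IsLocallyFinitelyPresentable.{v} C]

attribute [local instance] Cardinal.fact_isRegular_aleph0

lemma exists_finitelyPresentable_family :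
    ∃ (ι : Type v) (obj : ι → C), (∀ i, IsFinitelyPresentable.{v} (obj i)) ∧
      ∀ X : C, IsFinitelyPresentable.{v} X → ∃ i, Nonempty (obj i ≅ X) := by
  obtain ⟨Q, _, h₁, h₂⟩ := ObjectProperty.EssentiallySmall.exists_small_le.{v}
    (isCardinalPresentable C ℵ₀)
  have : Small.{v} (Subtype Q) := inferInstanceAs (ObjectProperty.Small.{v} Q)
  refine ⟨Shrink.{v} (Subtype Q), fun i => ((equivShrink _).symm i).1,
    fun i => h₁ _ ((equivShrink _).symm i).2, fun X hX => ?_⟩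
  obtain ⟨Y, hY, ⟨e⟩⟩ := h₂ X hX
  exact ⟨equivShrink _ ⟨Y, hY⟩, ⟨eqToIso (by simp) ≪≫ e.symm⟩⟩

variable {C}

lemma exists_directed_presentation (A : C) :
    ∃ (α : Type v) (_ : PartialOrder α) (_ : IsDirectedOrder α) (_ : Nonempty α) (D : α ⥤ C)
      (c : Cocone D) (_ : IsColimit c), c.pt = A ∧ ∀ i, IsFinitelyPresentable.{v} (D.obj i) := by
  obtain ⟨P, _, hP⟩ := HasCardinalFilteredGenerator.exists_small_generator C ℵ₀
  obtain ⟨J, _, _, ⟨p⟩⟩ := hP.exists_colimitsOfShape A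
  have hfil : IsFiltered J := isFiltered_of_isCardinalFiltered J ℵ₀
  obtain ⟨α, _, _, _, F, _⟩ := IsFiltered.exists_directed J
  exact ⟨α, inferInstance, inferInstance, inferInstance, F ⋙ p.diag, _,
    (Functor.Final.isColimitWhiskerEquiv F _).symm p.isColimit, rfl,
    fun i => hP.le_isCardinalPresentable _ (p.prop_diag_obj _)⟩

variable (C) in
/-- Downward Löwenheim–Skolem: for `δ` large enough, every morphism from a `δ`-presentable object
to `A` factors through a pure morphism from a `δ`-presentable object to `A`. The latter is the
colimit of a directed presentation of `A` over a set of fewer than `δ` indices which is closed under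
solutions of the finitely presentable extension problems solvable in `A`. -/
lemma exists_factorization_pureMono :
    ∃ γ : Cardinal.{v}, γ.IsRegular ∧ ∀ (δ : Cardinal.{v}) [Fact δ.IsRegular], γ ≤ δ →
      ∀ (A₀ A : C) (f : A₀ ⟶ A), IsCardinalPresentable A₀ δ →
        ∃ (A₁ : C) (g : A₀ ⟶ A₁) (h : A₁ ⟶ A), IsCardinalPresentable A₁ δ ∧ pureMono C h ∧
          g ≫ h = f := by
  obtain ⟨ι, obj, hobj, hι⟩ := exists_finitelyPresentable_family C
  -- the spans `obj b ⟵ obj a ⟶ obj c` of finitely presentable objects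
  let E := Σ a b c : ι, (obj a ⟶ obj b) × (obj a ⟶ obj c)
  refine ⟨Order.succ (max ℵ₀ #E), isRegular_succ (le_max_left _ _), fun δ _ hδ A₀ A f hA₀ => ?_⟩
  have hδ' : max ℵ₀ #E < δ := Order.succ_le_iff.1 hδ
  have hδ₀ : ℵ₀ < δ := (le_max_left _ _).trans_lt hδ'
  have hE : #E < δ := (le_max_right _ _).trans_lt hδ'
  obtain ⟨α, _, _, _, D, c, hc, rfl, hD⟩ := exists_directed_presentation A
  choose l el using fun i => hι (D.obj i) (hD i)
  replace el (i : α) : obj (l i) ≅ D.obj i := (el i).some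
  -- solutions of the finitely presentable extension problem posed at stage `i` by a span
  let Sol (e : E) (i k : α) : Prop := ∃ (_ : i ≤ k) (h : e.2.2.1 = l i) (y : obj e.2.1 ⟶ D.obj k),
    e.2.2.2.2 ≫ eqToHom (by rw [h]) ≫ (el i).hom ≫ D.map (homOfLE ‹i ≤ k›) = e.2.2.2.1 ≫ y
  have hφ (e : E) (i : α) : ∃ k, (∃ k', Sol e i k') → Sol e i k := by
    by_cases h : ∃ k', Sol e i k'
    · exact ⟨h.choose, fun _ => h.choose_spec⟩
    · exact ⟨i, fun h' => (h h').elim⟩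
  choose φ hφ using hφ
  choose β hβ₁ hβ₂ using fun i j : α => exists_ge_ge i j
  obtain ⟨a⟩ := ‹Nonempty α›
  have := isCardinalFiltered_closedSet a β φ hδ₀ hE
  have : IsFiltered (ClosedSet a β φ δ) := isFiltered_of_isCardinalFiltered _ δ
  have : IsDirectedOrder (ClosedSet a β φ δ) := IsFiltered.isDirectedOrder _
  have hcol := isColimitSubColimitCocone hc (P := ClosedSet a β φ δ) (fun S => S.1)
    (fun _ _ h => h) (fun i => by
      obtain ⟨S, hS⟩ := exists_closedSet_superset a β φ hδ₀ hE {i}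
        (by simpa using one_lt_aleph0.trans hδ₀)
      exact ⟨S, hS rfl⟩)
  obtain ⟨⟨S, hS, ha, hSβ, hSφ⟩, g, hg⟩ := IsCardinalPresentable.exists_hom_of_isColimit δ hcol f
  have hDδ (i : α) : IsCardinalPresentable (D.obj i) δ :=
    have := hD i
    isCardinalPresentable_of_le _ hδ₀.le
  refine ⟨subColimit D S, g, subColimitDesc c S, isCardinalPresentable_subColimit D hS,
    IsPure.pureMono fun X Y hX hY z s t e => ?_, hg⟩
  have : Nonempty S := ⟨⟨a, ha⟩⟩
  have : IsDirectedOrder S := ⟨fun i j => ⟨⟨β i j, hSβ _ i.2 _ j.2⟩, hβ₁ _ _, hβ₂ _ _⟩⟩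
  obtain ⟨x', ⟨ex⟩⟩ := hι X hX
  obtain ⟨y', ⟨ey⟩⟩ := hι Y hY
  obtain ⟨i, hi, x, rfl⟩ := exists_of_subColimit hX s
  obtain ⟨j, y, rfl⟩ := IsFinitelyPresentable.exists_hom_of_isColimit hc t
  obtain ⟨k, u, v, huv⟩ := IsFinitelyPresentable.exists_eq_of_isColimit hc x (z ≫ y)
    (by simpa [subColimitDesc] using e)
  let span : E := ⟨x', y', l i, ex.hom ≫ z ≫ ey.inv, ex.hom ≫ x ≫ (el i).inv⟩
  obtain ⟨hle, _, d, hd⟩ := hφ span i ⟨k, leOfHom u, rfl, ey.hom ≫ y ≫ D.map v, by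
    have : D.map (homOfLE (leOfHom u)) = D.map u := rfl
    simp [span, this, huv]⟩
  refine ⟨ey.inv ≫ d ≫ subι D (hSφ span i hi), ?_⟩
  have hd' : x ≫ D.map (homOfLE hle) = z ≫ ey.inv ≫ d := by
    rw [← cancel_epi ex.hom]
    simpa [span] using hd
  rw [← map_subι D (homOfLE hle) hi (hSφ span i hi), reassoc_of% hd']

end LowenheimSkolem

/-! ### The terminal object -/

section Terminal

variable (C : Type u) [Category.{v} C] [IsLocallyFinitelyPresentable.{v} C]

attribute [local instance] Cardinal.fact_isRegular_aleph0

/-- The terminal object is the colimit of all finitely presentable objects: each of these has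
exactly one map to it. -/
lemma hasTerminal_of_isLocallyFinitelyPresentable : HasTerminal C := by
  let P := isCardinalPresentable C Cardinal.aleph0.{v}
  have : IsCardinalFiltered P.FullSubcategory Cardinal.aleph0.{v} :=
    ⟨fun {A} _ F hA => ⟨by
      have : P.IsClosedUnderColimitsOfShape A :=
        isClosedUnderColimitsOfShape_isCardinalPresentable C hA
      exact colimit.cocone F⟩⟩
  have : IsFiltered P.FullSubcategory := isFiltered_of_isCardinalFiltered _ Cardinal.aleph0.{v}
  have : HasColimitsOfShape P.FullSubcategory C :=
    hasColimitsOfShape_of_equivalence (equivSmallModel.{v} P.FullSubcategory).symm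
  have uniq (X : C) (a b : X ⟶ colimit P.ι) : a = b := by
    obtain ⟨Q, _, hQ⟩ := HasCardinalFilteredGenerator.exists_small_generator C Cardinal.aleph0.{v}
    refine hQ.isStrongGenerator.isSeparating _ _ fun G hG g => ?_
    have hG' : IsCardinalPresentable G Cardinal.aleph0.{v} := hQ.le_isCardinalPresentable _ hG
    have h (c : G ⟶ colimit P.ι) : c = colimit.ι P.ι ⟨G, hG'⟩ := by
      obtain ⟨H, d, hd⟩ := IsCardinalPresentable.exists_hom_of_isColimit Cardinal.aleph0.{v}
        (colimit.isColimit P.ι) c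
      rw [← hd]
      exact colimit.w P.ι (ObjectProperty.homMk d : (⟨G, hG'⟩ : P.FullSubcategory) ⟶ H)
    rw [h (g ≫ a), h (g ≫ b)]
  have (X : C) : Nonempty (X ⟶ colimit P.ι) := by
    obtain ⟨α, _, _, _, D, c, hc, rfl, hD⟩ := exists_directed_presentation X
    exact ⟨hc.desc (Cocone.mk _ { app := fun i => colimit.ι P.ι ⟨D.obj i, hD i⟩
                                  naturality := fun _ _ _ => uniq _ _ _ })⟩
  have (X : C) : Unique (X ⟶ colimit P.ι) := ⟨⟨(this X).some⟩, fun _ => uniq _ _ _⟩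
  exact hasTerminal_of_unique (colimit P.ι)

end Terminal

/-! ### The weak factorization system of bounded pure monomorphisms -/

section Closure

variable {C : Type u} [Category.{v} C]

lemma pushouts_isoClosure (W : MorphismProperty C) : W.isoClosure.pushouts = W.pushouts :=
  le_antisymm (MorphismProperty.pushouts_le_iff.2
    ((MorphismProperty.isoClosure_le_iff _ _).2 W.le_pushouts))
    (MorphismProperty.pushouts_monotone W.le_isoClosure)

lemma rlp_isoClosure (W : MorphismProperty C) : W.isoClosure.rlp = W.rlp := by
  rw [← MorphismProperty.rlp_pushouts, pushouts_isoClosure, MorphismProperty.rlp_pushouts]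

lemma cof_isoClosure (W : MorphismProperty C) : cof W.isoClosure = cof W := by
  rw [cof, cof, pushouts_isoClosure]

lemma injectives_of_rlp {W : MorphismProperty C} {R T : C} (hT : IsTerminal T) {p : R ⟶ T}
    (hp : W.rlp p) : injectives W R := fun A B n hn g => by
  have := hp n hn
  have sq : CommSq g n p (hT.from B) := ⟨hT.hom_ext _ _⟩
  exact ⟨sq.lift, sq.fac_left⟩

lemma rlp_of_injectives {W : MorphismProperty C} {R T : C} (hT : IsTerminal T) (p : R ⟶ T)
    (hR : injectives W R) : W.rlp p := fun A B n hn => ⟨fun {g t} sq => by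
  obtain ⟨w, hw⟩ := hR n hn g
  exact ⟨⟨⟨w, hw, hT.hom_ext _ _⟩⟩⟩⟩

lemma llp_rlp_le_injectivityMaps [HasTerminal C] (W : MorphismProperty C) :
    W.rlp.llp ≤ injectivityMaps (injectives W) := fun A B f hf R hR g => by
  have := hf _ (rlp_of_injectives terminalIsTerminal (terminal.from R) hR)
  have sq : CommSq g f (terminal.from R) (terminal.from B) := ⟨terminalIsTerminal.hom_ext _ _⟩
  exact ⟨sq.lift, sq.fac_left⟩

/-- A small set of morphisms with `κ`-presentable domains permits the small object argument. -/
lemma hasSmallObjectArgument_of_isCardinalPresentable [HasColimitsOfSize.{v, v} C]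
    (W : MorphismProperty C) [MorphismProperty.IsSmall.{v} W] (κ : Cardinal.{v}) [Fact κ.IsRegular]
    (hW : ∀ ⦃X Y : C⦄ (f : X ⟶ Y), W f → IsCardinalPresentable X κ) :
    MorphismProperty.HasSmallObjectArgument.{v} W := by
  have : Nonempty κ.ord.ToType := by
    simpa using (Fact.out : κ.IsRegular).ne_zero
  have := WellFoundedLT.toOrderBot κ.ord.ToType
  exact ⟨κ, inferInstance, inferInstance,
    { preservesColimit := fun {A _ _ _} i hi _ _ => by
        have := hW i hi
        have := preservesColimitsOfShape_of_isCardinalPresentable A κ κ.ord.ToType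
        infer_instance }⟩

end Closure

section Bounded

variable (C : Type u) [Category.{v} C] [IsLocallyFinitelyPresentable.{v} C]
  (δ : Cardinal.{v}) [Fact δ.IsRegular]

attribute [local instance] Cardinal.fact_isRegular_aleph0

lemma isCardinalLocallyPresentable_of_isLocallyFinitelyPresentable :
    IsCardinalLocallyPresentable C δ :=
  IsCardinalLocallyPresentable.of_le C (Cardinal.IsRegular.aleph0_le (Fact.out : δ.IsRegular))

omit [IsLocallyFinitelyPresentable.{v} C] in
lemma pureMonoBetween_le : pureMonoBetween C δ ≤ pureMono C := fun _ _ _ h => h.1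

instance : (pureMonoBetween C δ).RespectsIso :=
  MorphismProperty.RespectsIso.of_respects_arrow_iso _ fun f g e hf => by
    have : IsCardinalPresentable (Arrow.leftFunc.obj f) δ := hf.2.1
    have : IsCardinalPresentable (Arrow.rightFunc.obj f) δ := hf.2.2
    exact ⟨((pureMono C).arrow_mk_iso_iff e).1 hf.1,
      isCardinalPresentable_of_iso (Arrow.leftFunc.mapIso e) δ,
      isCardinalPresentable_of_iso (Arrow.rightFunc.mapIso e) δ⟩

lemma exists_isSmall_isoClosure_eq_pureMonoBetween :
    ∃ S : MorphismProperty C, MorphismProperty.IsSmall.{v} S ∧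
      S.isoClosure = pureMonoBetween C δ := by
  have := isCardinalLocallyPresentable_of_isLocallyFinitelyPresentable C δ
  obtain ⟨Q, _, hQ⟩ := ObjectProperty.EssentiallySmall.exists_small.{v} (isCardinalPresentable C δ)
  have : Small.{v} (Subtype Q) := inferInstanceAs (ObjectProperty.Small.{v} Q)
  let w (x : Σ (a b : Subtype Q), { f : a.1 ⟶ b.1 // pureMonoBetween C δ f }) := x.2.2.1
  refine ⟨MorphismProperty.ofHoms w, inferInstance, le_antisymm ?_ ?_⟩
  · rw [MorphismProperty.isoClosure_le_iff]
    rintro _ _ _ ⟨x⟩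
    exact x.2.2.2
  · intro A B f hf
    obtain ⟨A', hA', ⟨eA⟩⟩ := (hQ ▸ hf.2.1 : Q.isoClosure A)
    obtain ⟨B', hB', ⟨eB⟩⟩ := (hQ ▸ hf.2.2 : Q.isoClosure B)
    have e : Arrow.mk (eA.inv ≫ f ≫ eB.hom) ≅ Arrow.mk f := Arrow.isoMk eA.symm eB.symm
    have hf' := ((pureMonoBetween C δ).arrow_mk_iso_iff e).2 hf
    exact ⟨_, _, _, MorphismProperty.ofHoms.mk (f := w) ⟨⟨A', hA'⟩, ⟨B', hB'⟩, ⟨_, hf'⟩⟩, ⟨e⟩⟩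

lemma llp_rlp_pureMonoBetween : (pureMonoBetween C δ).rlp.llp = cof (pureMonoBetween C δ) := by
  obtain ⟨S, _, hS⟩ := exists_isSmall_isoClosure_eq_pureMonoBetween C δ
  rw [← hS, rlp_isoClosure, cof_isoClosure]
  exact llp_rlp_eq_cof S δ fun X Y f hf => (hS ▸ S.le_isoClosure f hf : pureMonoBetween C δ f).2.1

lemma hasFunctorialFactorization_pureMonoBetween :
    MorphismProperty.HasFunctorialFactorization (cof (pureMonoBetween C δ))
      (pureMonoBetween C δ).rlp := by
  obtain ⟨S, _, hS⟩ := exists_isSmall_isoClosure_eq_pureMonoBetween C δ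
  have := hasSmallObjectArgument_of_isCardinalPresentable S δ fun X Y f hf =>
    (hS ▸ S.le_isoClosure f hf : pureMonoBetween C δ f).2.1
  rw [← llp_rlp_pureMonoBetween, ← hS, rlp_isoClosure]
  infer_instance

lemma cof_pureMonoBetween_le : cof (pureMonoBetween C δ) ≤ pureMono C :=
  cof_le_pureMono (MorphismProperty.pushouts_le_iff.2 (pureMonoBetween_le C δ))

variable {C} in
omit [IsLocallyFinitelyPresentable.{v} C] in
lemma pureMonoBetween_monotone {δ' : Cardinal.{v}} [Fact δ'.IsRegular] (h : δ ≤ δ') :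
    pureMonoBetween C δ ≤ pureMonoBetween C δ' := fun _ _ _ hf =>
  ⟨hf.1, isCardinalPresentable_monotone C h _ hf.2.1, isCardinalPresentable_monotone C h _ hf.2.2⟩

/-- If morphisms from `δ`-presentable objects factor through pure ones, then every `δ`-presentable
pure monomorphism is a pushout of a pure monomorphism between `δ`-presentable objects. -/
lemma presPureMono_eq_pushouts
    (hδ : ∀ (A₀ A : C) (f : A₀ ⟶ A), IsCardinalPresentable A₀ δ →
      ∃ (A₁ : C) (g : A₀ ⟶ A₁) (h : A₁ ⟶ A), IsCardinalPresentable A₁ δ ∧ pureMono C h ∧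
        g ≫ h = f) :
    presPureMono C δ = (pureMonoBetween C δ).pushouts := by
  have := isCardinalLocallyPresentable_of_isLocallyFinitelyPresentable C δ
  ext A B f
  constructor
  · rintro ⟨hf, _⟩
    obtain ⟨X, Y, f₀, a, b, hX, hY, sq⟩ := exists_isPushout_of_isCardinalPresentable (κ := δ) f
    obtain ⟨A₁, g, h, hA₁, hh, rfl⟩ := hδ _ _ a hX
    have sq₁ := IsPushout.of_hasPushout g f₀
    have hB₁ : IsCardinalPresentable (pushout g f₀) δ :=
      isCardinalPresentable_colimit_of_finCategory _ (by
        rintro (_ | _ | _)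
        exacts [hX, hA₁, hY])
    let k : pushout g f₀ ⟶ B := pushout.desc (h ≫ f) b (by simpa using sq.w)
    have hk : pushout.inl g f₀ ≫ k = h ≫ f := pushout.inl_desc _ _ _
    have sq₂ : IsPushout h (pushout.inl g f₀) f k := by
      refine IsPushout.of_left (h₁₁ := g) (v₁₁ := f₀) (h₂₁ := pushout.inr g f₀) ?_ hk.symm sq₁
      rwa [pushout.inr_desc]
    -- the pushout of `f₀` along `g` is a first factor of the pure monomorphism `h ≫ f`
    refine ⟨_, _, _, _, _, ⟨?_, hA₁, hB₁⟩, sq₂⟩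
    apply pureMono.of_comp (g := k)
    rw [hk]
    exact (pureMono C).comp_mem _ _ hh hf
  · rintro ⟨X, Y, f₀, a, b, ⟨hf₀, hX, hY⟩, sq⟩
    exact ⟨(pureMono C).of_isPushout sq hf₀, isCardinalPresentable_underMk_of_isPushout sq⟩

variable {C δ}

lemma exists_cof_injectives (hM : presPureMono C δ = (pureMonoBetween C δ).pushouts) (A : C) :
    ∃ (R : C) (r : A ⟶ R), cof (pureMonoBetween C δ) r ∧ injectives (presPureMono C δ) R := by
  have := hasTerminal_of_isLocallyFinitelyPresentable C
  have := hasFunctorialFactorization_pureMonoBetween C δ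
  let h := MorphismProperty.factorizationData (cof (pureMonoBetween C δ)) (pureMonoBetween C δ).rlp
    (terminal.from A)
  refine ⟨h.Z, h.i, h.hi, injectives_of_rlp terminalIsTerminal (p := h.p) ?_⟩
  rw [hM, MorphismProperty.rlp_pushouts]
  exact h.hp

lemma isWeakReflection_of_cof (hM : presPureMono C δ = (pureMonoBetween C δ).pushouts) {A R : C}
    {r : A ⟶ R} (hr : cof (pureMonoBetween C δ) r) (hR : injectives (presPureMono C δ) R) :
    IsWeakReflection (injectives (presPureMono C δ)) r := by
  have := hasTerminal_of_isLocallyFinitelyPresentable C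
  refine ⟨hR, llp_rlp_le_injectivityMaps _ _ ?_⟩
  rwa [hM, MorphismProperty.rlp_pushouts, llp_rlp_pureMonoBetween]

/-- A morphism with respect to which an injective hull of its domain is injective is a first factor
of a pure monomorphism. -/
lemma pureMono_of_injectivityMaps (hM : presPureMono C δ = (pureMonoBetween C δ).pushouts) {A B : C}
    {f : A ⟶ B} (hf : injectivityMaps (injectives (presPureMono C δ)) f) : pureMono C f := by
  obtain ⟨R, r, hr, hR⟩ := exists_cof_injectives hM A
  obtain ⟨w, rfl⟩ := hf hR r
  exact pureMono.of_comp (cof_pureMonoBetween_le C δ _ hr)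

lemma presentablePart_injectivityMaps (hM : presPureMono C δ = (pureMonoBetween C δ).pushouts) :
    presentablePart δ (injectivityMaps (injectives (presPureMono C δ))) = presPureMono C δ := by
  ext A B f
  exact ⟨fun hf => ⟨pureMono_of_injectivityMaps hM hf.1, hf.2⟩,
    fun hf => ⟨fun R hR g => hR f hf g, hf.2⟩⟩

lemma isWeakFactorizationSystem_pureMonoBetween :
    MorphismProperty.IsWeakFactorizationSystem (cof (pureMonoBetween C δ))
      (pureMonoBetween C δ).rlp :=
  have := hasFunctorialFactorization_pureMonoBetween C δ
  { rlp := by rw [← llp_rlp_pureMonoBetween, MorphismProperty.rlp_llp_rlp]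
    llp := llp_rlp_pureMonoBetween C δ }

end Bounded

/-! ### Chains of weak reflectors -/

section Chain

variable {C : Type u} [Category.{v} C] [IsLocallyFinitelyPresentable.{v} C]

/-- The chain is obtained from an ordinal chain whose step at the initial ordinal of `δ` is a weak
reflector for `δ`, all other steps being isomorphisms; its member of index `δ` is the stage just
after that step. All steps up to there are cofibrations for `δ`, by monotonicity in `δ`. -/
lemma exists_isReflectorChain (γ : Cardinal.{v})
    (hγ : ∀ (δ : RegularFrom γ) (A : C), ∃ (R : C) (r : A ⟶ R),
      cof (pureMonoBetween C δ.1) r ∧ injectives (presPureMono C δ.1) R) (A : C) :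
    ∃ F : RegularFrom γ ⥤ Under A, IsReflectorChain F := by
  obtain ⟨F, hF, rfl, hP⟩ := exists_ordinal_chain A
    (fun α _ X f => (∀ δ : RegularFrom γ, α = δ.1.ord →
      cof (pureMonoBetween C δ.1) f ∧ injectives (presPureMono C δ.1) X) ∧
      ((∀ δ : RegularFrom γ, α ≠ δ.1.ord) → IsIso f)) (fun α G => by
    by_cases h : ∃ δ : RegularFrom γ, α = δ.1.ord
    · obtain ⟨δ, hδ⟩ := h
      obtain ⟨R, r, hr, hR⟩ := hγ δ (G.obj ⟨α, Order.lt_succ α⟩)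
      refine ⟨R, r, fun δ' hδ' => ?_, fun h => (h δ hδ).elim⟩
      obtain rfl : δ = δ' := Subtype.ext (Cardinal.ord_injective (hδ.symm.trans hδ'))
      exact ⟨hr, hR⟩
    · exact ⟨_, 𝟙 _, fun δ hδ => (h ⟨δ, hδ⟩).elim, fun _ => inferInstance⟩)
  have hmono : Monotone fun δ : RegularFrom γ => Order.succ δ.1.ord := fun δ δ' h =>
    Order.succ_le_succ (Cardinal.ord_le_ord.2 h)
  refine ⟨Under.lift (hmono.functor ⋙ F)
    { app := fun δ => F.map (homOfLE bot_le)
      naturality := fun δ δ' f => (Category.id_comp _).trans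
        (F.map_comp (homOfLE bot_le : ⊥ ⟶ Order.succ δ.1.ord) (hmono.functor.map f)) },
    fun δ => ⟨?_, ((hP _).1 δ rfl).2⟩⟩
  change cof (pureMonoBetween C δ.1) (F.map (homOfLE bot_le : ⊥ ⟶ Order.succ δ.1.ord))
  have hstep (β : Ordinal.{v}) (hβ : β < Order.succ δ.1.ord) :
      (pureMonoBetween C δ.1).rlp.llp (F.map (homOfLE (Order.le_succ β))) := by
    by_cases hβ' : ∃ δ' : RegularFrom γ, β = δ'.1.ord
    · obtain ⟨δ', rfl⟩ := hβ'
      have hle : δ'.1 ≤ δ.1 := Cardinal.ord_le_ord.1 (Order.lt_succ_iff.1 hβ)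
      exact MorphismProperty.antitone_llp
        (MorphismProperty.antitone_rlp (pureMonoBetween_monotone δ'.1 hle)) _
        (cof_le_llp_rlp _ _ ((hP _).1 δ' rfl).1)
    · have : IsIso (F.map (homOfLE (Order.le_succ β))) := (hP β).2 fun δ' h => hβ' ⟨δ', h⟩
      exact fun _ _ p _ => HasLiftingProperty.of_left_iso _ p
  have h := MorphismProperty.transfiniteCompositions_le_llp_rlp.{v}
    (pureMonoBetween C δ.1).rlp.llp _ (transfiniteCompositions_map_bot hF _ _ hstep)
  rwa [MorphismProperty.rlp_llp_rlp, llp_rlp_pureMonoBetween] at h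

lemma exists_regular_isCardinalPresentable (δ : Cardinal.{v}) (hδ : Cardinal.aleph0 ≤ δ) (U V : C) :
    ∃ (ζ : Cardinal.{v}) (_ : Fact ζ.IsRegular), δ < ζ ∧ IsCardinalPresentable U ζ ∧
      IsCardinalPresentable V ζ := by
  have := Cardinal.fact_isRegular_aleph0.{v}
  have : IsLocallyPresentable.{v} C := ⟨Cardinal.aleph0, inferInstance, inferInstance⟩
  obtain ⟨κ, _, hκ⟩ := (inferInstance : IsPresentable.{v} U).exists_cardinal
  obtain ⟨κ', _, hκ'⟩ := (inferInstance : IsPresentable.{v} V).exists_cardinal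
  have : Fact (Order.succ (max δ (max κ κ'))).IsRegular :=
    ⟨Cardinal.isRegular_succ (hδ.trans (le_max_left _ _))⟩
  have h := Order.lt_succ (max δ (max κ κ'))
  simp only [max_lt_iff] at h
  exact ⟨_, this, h.1, isCardinalPresentable_of_le U h.2.1.le,
    isCardinalPresentable_of_le V h.2.2.le⟩

/-- A stage which is a retract of all later ones is injective with respect to every pure
monomorphism `n`, since it is a retract of a stage whose index bounds the domain and the codomain
of `n`. -/
lemma exists_pureMono_of_weaklyStabilizes {γ : Cardinal.{v}}
    (hγ : ∀ δ : RegularFrom γ, presPureMono C δ.1 = (pureMonoBetween C δ.1).pushouts) {A : C}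
    {F : RegularFrom γ ⥤ Under A} (hF : IsReflectorChain F) (hF' : WeaklyStabilizes F) :
    ∃ (R : C) (r : A ⟶ R), pureMono C r ∧ injectives (pureMono C) R := by
  obtain ⟨δ, hδ⟩ := hF'
  refine ⟨_, (F.obj δ).hom, cof_pureMonoBetween_le C δ.1 _ (hF δ).1, fun U V n hn g => ?_⟩
  obtain ⟨ζ, hζ, hlt, hU, hV⟩ :=
    exists_regular_isCardinalPresentable δ.1 (Cardinal.IsRegular.aleph0_le δ.2.1) U V
  let ζ' : RegularFrom γ := ⟨ζ, hζ.out, δ.2.2.trans hlt.le⟩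
  have := hδ ζ' hlt
  have hn' : presPureMono C ζ'.1 n := by
    rw [hγ ζ']
    exact MorphismProperty.le_pushouts _ _ ⟨hn, hU, hV⟩
  obtain ⟨w, hw⟩ := (hF ζ').2 n hn' (g ≫ (F.map (homOfLE (show δ ≤ ζ' from hlt.le))).right)
  exact ⟨w ≫ retraction (F.map (homOfLE (show δ ≤ ζ' from hlt.le))).right, by
    rw [reassoc_of% hw]
    simp⟩

end Chain

end PureWFS

theorem mainTheorem8 (C : Type u) [Category.{v} C] [IsLocallyFinitelyPresentable.{v} C] :
    ∃ γ : Cardinal.{v}, γ.IsRegular ∧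
      (∀ (δ : Cardinal.{v}) [Fact δ.IsRegular], γ ≤ δ →
        -- enough injectives with respect to the `δ`-presentable pure monos
        (∀ A : C, ∃ (R : C) (r : A ⟶ R), PureWFS.pureMono C r ∧
          PureWFS.IsWeakReflection (PureWFS.injectives (PureWFS.presPureMono C δ)) r) ∧
        -- all weak reflectors are pure monos
        (∀ (A R : C) (r : A ⟶ R),
          PureWFS.IsWeakReflection (PureWFS.injectives (PureWFS.presPureMono C δ)) r →
            PureWFS.pureMono C r) ∧
        -- the `δ`-presentable pure monos are the pushouts of those between
        -- `δ`-presentable objects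
        PureWFS.presPureMono C δ = (PureWFS.pureMonoBetween C δ).pushouts ∧
        -- the associated functorial weak factorization system
        PureWFS.presentablePart δ
          (PureWFS.injectivityMaps (PureWFS.injectives (PureWFS.presPureMono C δ))) =
            PureWFS.presPureMono C δ ∧
        MorphismProperty.IsWeakFactorizationSystem
          (PureWFS.reCh (PureWFS.presPureMono C δ)) (PureWFS.presPureMono C δ).rlp ∧
        MorphismProperty.HasFunctorialFactorization
          (PureWFS.reCh (PureWFS.presPureMono C δ)) (PureWFS.presPureMono C δ).rlp ∧
        -- it is cofibrantly generated by the pure monos between `δ`-presentable objects,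
        PureWFS.reCh (PureWFS.presPureMono C δ) = PureWFS.cof (PureWFS.pureMonoBetween C δ) ∧
        (PureWFS.presPureMono C δ).rlp = (PureWFS.pureMonoBetween C δ).rlp ∧
        -- which form, up to isomorphism, a small set
        (∃ S : MorphismProperty C, MorphismProperty.IsSmall.{v} S ∧
          S.isoClosure = PureWFS.pureMonoBetween C δ ∧
          PureWFS.reCh (PureWFS.presPureMono C δ) = PureWFS.cof S ∧
          (PureWFS.presPureMono C δ).rlp = S.rlp)) ∧
      -- the chains of weak reflectors
      (∀ A : C, ∃ F : PureWFS.RegularFrom γ ⥤ Under A, PureWFS.IsReflectorChain F) ∧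
      -- weak stabilization yields enough pure-injectives
      (∀ (A : C) (F : PureWFS.RegularFrom γ ⥤ Under A), PureWFS.IsReflectorChain F →
        PureWFS.WeaklyStabilizes F → ∃ (R : C) (r : A ⟶ R), PureWFS.pureMono C r ∧
          PureWFS.injectives (PureWFS.pureMono C) R) := by
  obtain ⟨γ, hγ, hLS⟩ := PureWFS.exists_factorization_pureMono C
  have hM (δ : Cardinal.{v}) [Fact δ.IsRegular] (hδ : γ ≤ δ) :=
    PureWFS.presPureMono_eq_pushouts C δ (hLS δ hδ)
  refine ⟨γ, hγ, fun δ _ hδ => ?_, fun A => ?_, fun A F hF hF' => ?_⟩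
  · have h := hM δ hδ
    have hre : PureWFS.reCh (PureWFS.presPureMono C δ) =
        PureWFS.cof (PureWFS.pureMonoBetween C δ) := congrArg PureWFS.reCh h
    have hrlp : (PureWFS.presPureMono C δ).rlp = (PureWFS.pureMonoBetween C δ).rlp := by
      rw [h, MorphismProperty.rlp_pushouts]
    refine ⟨fun A => ?_, fun A R r hr => PureWFS.pureMono_of_injectivityMaps h hr.2, h,
      PureWFS.presentablePart_injectivityMaps h, ?_, ?_, hre, hrlp, ?_⟩
    · obtain ⟨R, r, hr, hR⟩ := PureWFS.exists_cof_injectives h A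
      exact ⟨R, r, PureWFS.cof_pureMonoBetween_le C δ r hr, PureWFS.isWeakReflection_of_cof h hr hR⟩
    · rw [hre, hrlp]
      exact PureWFS.isWeakFactorizationSystem_pureMonoBetween
    · rw [hre, hrlp]
      exact PureWFS.hasFunctorialFactorization_pureMonoBetween C δ
    · obtain ⟨S, hS, hS'⟩ := PureWFS.exists_isSmall_isoClosure_eq_pureMonoBetween C δ
      exact ⟨S, hS, hS', by rw [hre, ← hS', PureWFS.cof_isoClosure],
        by rw [hrlp, ← hS', PureWFS.rlp_isoClosure]⟩
  · exact PureWFS.exists_isReflectorChain γ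
      (fun δ A => PureWFS.exists_cof_injectives (hM δ.1 δ.2.2) A) A
  · exact PureWFS.exists_pureMono_of_weaklyStabilizes (fun δ => hM δ.1 δ.2.2) hF hF'
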